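/- **Setting.** Let $\Theta\subset\mathbb{R}^{n}$ be convex and closed, $c\in\mathbb{R}^{n}$, let $\mathbb{Q}$ carry a probability measure $\mu$, and let $f:\Theta\times\mathbb{Q}\to\mathbb{R}$ be (jointly) measurable and convex in $\theta$ for each fixed $q$. Write $V(\theta)=\mu\{q: f(\theta,q)>0\}$. Assume that for every $N\ge 1$ and all $q^{(1)},\dots,q^{(N)}\in\mathbb{Q}$ the problem $\min_{\theta\in\Theta}c^T\theta$ subject to $f(\theta,q^{(i)})\le 0$, $i=1,\dots,N$, has a unique solution whenever it is feasible. Given a multisample of size $N$ and $m\le N$, the *scenario problem with $m$ retained samples* is the problem of minimizing $c^T\theta$ over $\theta\in\Theta$ subject to $f(\theta,q^{(i)})\le0$ for $i\in I$, where $I\subset\{1,\dots,N\}$, $|I|=m$, is also chosen so that the optimal value is smallest; the other $N-m$ samples are discarded. **Algorithm.** Choose $\varepsilon,\delta\in(0,1)$, integers $k_t>1$ and $r\ge0$, and set $\beta_w=\frac{1}{4\varepsilon}\ln\frac1\delta$ and $\beta_v=\max\{1,\ \beta_w(k_t\ln\frac{2k_t}{\delta})^{-1}\}$. Let $N$ be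 the smallest non-negative integer with $$\binom{r+n}{r}\sum_{i=0}^{r+n}\binom{N}{i}\varepsilon^i(1-\varepsilon)^{N-i}\le\frac{\delta}{2},$$ and choose integers $N_k\ge N\frac{k}{k_t}$ and $N_{k,r}$ with $\frac{(N-r)k}{k_t}\le N_{k,r}\le N_k$ for $1\le k\le k_t$, where $N_{k_t}-N_{k_t,r}\le r$, and $M_k\ge 2k\beta_v\frac1\varepsilon\ln\frac{2k_t}{\delta}$ for $1\le k<k_t$. For $k=1,2,\dots,k_t$: 1. Draw $N_k$ design samples and let $\widehat\theta_k$ be a solution (chosen measurably) of the scenario problem with $N_{k,r}$ retained samples. If that problem is infeasible, stop without a solution. 2. If $k=k_t$, exit with $\theta_{\rm sol}=\widehat\theta_k$. 3. If $k<k_t$, draw $M_k$ validation samples $q_v^{(i)}$; if $\frac1{M_k}\left|\{i: f(\widehat\theta_k,q_v^{(i)})>0\}\right|\le\left(1-(k\beta_v)^{-1/2}\right)\varepsilon$, exit with $\theta_{\rm sol}=\widehat\theta_k$; otherwise continue with iteration $k+1$. All design and validation samples of all iterations are independent with distribution $\mu$. **Theorem.** With probability at least $1-\delta$, the algorithm either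 stops without a solution or exits (at some iteration) with a solution $\theta_{\rm sol}$ such that $V(\theta_{\rm sol})\le\varepsilon$. -/

import Mathlib

open MeasureTheory ProbabilityTheory

noncomputable section

namespace SeqRand

/-- The data of the uncertain program `min cᵀθ` over `θ ∈ Θ ⊆ ℝⁿ` subject to `f(θ, q) ≤ 0` for all
`q ∈ Q`. Only the values of `f` on `Θ × Q` matter. -/
structure UncertainProgram (n : ℕ) (Q : Type*) where
  /-- cost vector -/
  c : EuclideanSpace ℝ (Fin n)
  /-- domain of the decision vector -/
  Θ : Set (EuclideanSpace ℝ (Fin n))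
  /-- constraint function -/
  f : EuclideanSpace ℝ (Fin n) → Q → ℝ

namespace UncertainProgram

variable {n : ℕ} {Q : Type*}

/-- The objective `cᵀθ`. -/
def cost (P : UncertainProgram n Q) (θ : EuclideanSpace ℝ (Fin n)) : ℝ :=
  ∑ j, P.c j * θ j

/-- Convexity assumption: `Θ` is convex and closed, and `f(·, q)` is convex on `Θ` for every `q`. -/
def IsConvex (P : UncertainProgram n Q) : Prop :=
  Convex ℝ P.Θ ∧ IsClosed P.Θ ∧ ∀ q, ConvexOn ℝ P.Θ (fun θ => P.f θ q)

/-- Probability of violation `V(θ) = Pr {q : f(θ, q) > 0}`. -/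
def violation [MeasurableSpace Q] (P : UncertainProgram n Q) (μ : Measure Q)
    (θ : EuclideanSpace ℝ (Fin n)) : ℝ :=
  μ.real {q | 0 < P.f θ q}

open Classical in
/-- Empirical violation of `θ` on the multisample `q`. -/
def empViolation (P : UncertainProgram n Q) (θ : EuclideanSpace ℝ (Fin n)) {M : ℕ}
    (q : Fin M → Q) : ℝ :=
  (1 / (M : ℝ)) * ∑ i, (if P.f θ (q i) ≤ 0 then (0 : ℝ) else 1)

/-- The points of `Θ` that satisfy the sampled constraints with index in `I`. -/
def feasibleSet (P : UncertainProgram n Q) {N : ℕ} (q : Fin N → Q) (I : Finset (Fin N)) :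
    Set (EuclideanSpace ℝ (Fin n)) :=
  {θ | θ ∈ P.Θ ∧ ∀ i ∈ I, P.f θ (q i) ≤ 0}

/-- `θ` solves the scenario problem `min cᵀθ` over `θ ∈ Θ` subject to `f(θ, q i) ≤ 0`, `i ∈ I`. -/
def IsScenarioSolution (P : UncertainProgram n Q) {N : ℕ} (q : Fin N → Q) (I : Finset (Fin N))
    (θ : EuclideanSpace ℝ (Fin n)) : Prop :=
  θ ∈ P.feasibleSet q I ∧ ∀ θ' ∈ P.feasibleSet q I, P.cost θ ≤ P.cost θ'

/-- Uniqueness assumption: every scenario problem (with at least one sample) that is feasible has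
exactly one solution. -/
def HasUniqueSolutions (P : UncertainProgram n Q) : Prop :=
  ∀ N : ℕ, 1 ≤ N → ∀ q : Fin N → Q, (P.feasibleSet q Finset.univ).Nonempty →
    ∃! θ, P.IsScenarioSolution q Finset.univ θ

/-- The scenario problem with `N` samples of which all but `m` are discarded is feasible: some `m`
of the sampled constraints can be satisfied simultaneously. -/
def DiscardedFeasible (P : UncertainProgram n Q) {N : ℕ} (m : ℕ) (q : Fin N → Q) : Prop :=
  ∃ J : Finset (Fin N), J.card = m ∧ (P.feasibleSet q J).Nonempty

/-- `θ` solves the scenario problem in which `m` of the `N` sampled constraints are kept (those with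
index in `I`) and the others are discarded, where the discarded constraints are chosen so that
the optimal value is the smallest possible. -/
def IsDiscardedSolution (P : UncertainProgram n Q) {N : ℕ} (m : ℕ) (q : Fin N → Q)
    (θ : EuclideanSpace ℝ (Fin n)) : Prop :=
  ∃ I : Finset (Fin N), I.card = m ∧ P.IsScenarioSolution q I θ ∧
    ∀ J : Finset (Fin N), J.card = m → ∀ θ' ∈ P.feasibleSet q J, P.cost θ ≤ P.cost θ'

end UncertainProgram

/-- `β_w = (1 / (4 ε)) ln (1 / δ)`. -/
def betaW (ε δ : ℝ) : ℝ := 1 / (4 * ε) * Real.log (1 / δ)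

/-- `β_v = max {1, β_w (k_t ln (2 k_t / δ))⁻¹}`. -/
def betaV (ε δ : ℝ) (kt : ℕ) : ℝ :=
  max 1 (betaW ε δ * ((kt : ℝ) * Real.log (2 * (kt : ℝ) / δ))⁻¹)

/-- `binom(r + n, r) ∑_{i = 0}^{r + n} binom(N, i) ε^i (1 - ε)^{N - i}`; the terms with `i > N`
vanish. -/
def discardBound (n r N : ℕ) (ε : ℝ) : ℝ :=
  ((r + n).choose r : ℝ) *
    ∑ i ∈ Finset.range (r + n + 1), (N.choose i : ℝ) * ε ^ i * (1 - ε) ^ (N - i)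

/-- Admissible sample sizes for the iterations `k = 1, …, k_t`: `Nd k` design samples, of which
`Nr k` are kept, and `M k` validation samples. There is no validation in the last iteration, and at
most `r` of the design samples of the last iteration are discarded. -/
structure AdmissibleSizes (n : ℕ) (ε δ : ℝ) (kt r : ℕ) (Nd Nr M : ℕ → ℕ) : Prop where
  design : ∃ N : ℕ, IsLeast {N : ℕ | discardBound n r N ε ≤ δ / 2} N ∧
    ∀ k, 1 ≤ k → k ≤ kt →
      (N : ℝ) * k / kt ≤ Nd k ∧ ((N : ℝ) - r) * k / kt ≤ Nr k ∧ Nr k ≤ Nd k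
  discarded : Nd kt - Nr kt ≤ r
  validation : ∀ k, 1 ≤ k → k < kt →
    2 * k * betaV ε δ kt * (1 / ε) * Real.log (2 * (kt : ℝ) / δ) ≤ M k

/-- What the algorithm reports: infeasibility, or a solution found in iteration `k`. -/
inductive Outcome (n : ℕ) where
  | infeasible : Outcome n
  | solution (k : ℕ) (θ : EuclideanSpace ℝ (Fin n)) : Outcome n

section Algorithm

variable {n : ℕ} {Q : Type*}

/-- `sol k q` is a solution of the design problem of iteration `k` for the design multisample `q`
whenever that problem is feasible, for `k = 1, …, k_t`. -/
def IsDesignSolver (P : UncertainProgram n Q) (kt : ℕ) (Nd Nr : ℕ → ℕ)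
    (sol : (k : ℕ) → (Fin (Nd k) → Q) → EuclideanSpace ℝ (Fin n)) : Prop :=
  ∀ k, 1 ≤ k → k ≤ kt → ∀ q : Fin (Nd k) → Q,
    P.DiscardedFeasible (Nr k) q → P.IsDiscardedSolution (Nr k) q (sol k q)

open Classical in
/-- The algorithm from iteration `k` on, when `j` further iterations are available after it, for the
design samples `qd` and the validation samples `qv`. -/
def runFrom (P : UncertainProgram n Q) (ε β : ℝ) {Nd : ℕ → ℕ} (Nr : ℕ → ℕ) {M : ℕ → ℕ}
    (sol : (k : ℕ) → (Fin (Nd k) → Q) → EuclideanSpace ℝ (Fin n))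
    (qd : (k : ℕ) → Fin (Nd k) → Q) (qv : (k : ℕ) → Fin (M k) → Q) : ℕ → ℕ → Outcome n
  | 0, k =>
    if P.DiscardedFeasible (Nr k) (qd k) then .solution k (sol k (qd k)) else .infeasible
  | j + 1, k =>
    if P.DiscardedFeasible (Nr k) (qd k) then
      if P.empViolation (sol k (qd k)) (qv k) ≤ (1 - ((k : ℝ) * β) ^ (-(1 / 2) : ℝ)) * ε then
        .solution k (sol k (qd k))
      else runFrom P ε β Nr sol qd qv j (k + 1)
    else .infeasible

/-- The sequential algorithm with partial constraint satisfaction: iterations `1, …, k_t`. -/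
def run (P : UncertainProgram n Q) (ε δ : ℝ) (kt : ℕ) {Nd : ℕ → ℕ} (Nr : ℕ → ℕ) {M : ℕ → ℕ}
    (sol : (k : ℕ) → (Fin (Nd k) → Q) → EuclideanSpace ℝ (Fin n))
    (qd : (k : ℕ) → Fin (Nd k) → Q) (qv : (k : ℕ) → Fin (M k) → Q) : Outcome n :=
  runFrom P ε (betaV ε δ kt) Nr sol qd qv (kt - 1) 1

/-- All design and validation samples, of all iterations, are independent with distribution `μ`. -/
def IsIIDSampling [MeasurableSpace Q] {Ω : Type*} [MeasurableSpace Ω] (μ : Measure Q)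
    (Pr : Measure Ω) {Nd M : ℕ → ℕ} (qd : (k : ℕ) → Fin (Nd k) → Ω → Q)
    (qv : (k : ℕ) → Fin (M k) → Ω → Q) : Prop :=
  (∀ k i, Measurable (qd k i) ∧ Pr.map (qd k i) = μ) ∧
  (∀ k i, Measurable (qv k i) ∧ Pr.map (qv k i) = μ) ∧
  iIndepFun (Sum.elim (fun p : (k : ℕ) × Fin (Nd k) => qd p.1 p.2)
    (fun p : (k : ℕ) × Fin (M k) => qv p.1 p.2)) Pr

end Algorithm

end SeqRand

end

/-! The algorithm returns a bad solution only if some validation accepts a bad design, or if the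
last design, which is not validated, is bad. A multiplicative Chernoff bound with `ρ = (k
β_v)^(-1/2)` gives at most `δ / (2 k_t)` for each of the `k_t - 1` validations
(`measureReal_freq_le_of_lt`, `exp_validation_le`). The last design contributes at most
`discardBound ≤ δ / 2` (`measureReal_lt_violation_le_discardBound`). A union bound finishes the
proof.

The estimate for the last design is the core. Add `k` ghost samples to the `N` design samples. By
exchangeability it suffices to count, for a fixed multisample of size `N + k`, the `N`-subsets whose
solution violates many of the other samples (`choose_mul_measureReal_le`). This count is bounded by
a hypergeometric tail. As `k → ∞` the tail becomes binomial, and then the loss `ρ` between frequency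
and probability tends to `0`.

The count is combinatorial. If every large set of constraints has exactly one basis of size `n + 1`,
double counting determines the number of bases with a given number of violators
(`IsViolatorMap.card_filter_eq`), whatever the constraints are. Discarding `s` samples so that the
optimum is smallest leaves a basis with exactly `s` violators in the design set
(`exists_padded_basis_violated`).

Scenario programs may be infeasible or degenerate, so they are replaced by a relaxation with one
slack variable, which is always feasible and, after a generic perturbation, has no coincidences
between bases. Every constraint violated by a scenario solution strictly raises the relaxed value
(`exists_generic_relaxation`). The slack variable makes the dimension `n + 1`, which is why sums up
to `r + n` appear. -/

namespace SeqRand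

/-! ### Counting bases and violators in an abstract violator map. -/

section Counting

/-- A Vandermonde-type convolution of binomial coefficients. -/
lemma sum_choose_mul_choose (n M i : ℕ) :
    ∑ l ∈ Finset.range (M + 1), (l + n).choose n * (M - l).choose i
      = (M + n + 1).choose (i + n + 1) := by
  induction M generalizing i with
  | zero =>
    rcases i with _ | i
    · simp
    · simp [Nat.choose_eq_zero_of_lt (show n + 1 < i + 1 + n + 1 by omega)]
  | succ M ih =>
    rcases i with _ | i
    · have h0 := ih 0
      rw [Finset.sum_range_succ]
      simp only [Nat.choose_zero_right, mul_one] at h0 ⊢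
      rw [h0]
      have := Nat.choose_succ_succ (M + n + 1) n
      have h1 : M + 1 + n + 1 = (M + n + 1) + 1 := by ring
      have h2 : 0 + n + 1 = n + 1 := by ring
      have h3 : M + 1 + n = M + n + 1 := by ring
      rw [h1, h2, h3]
      simp only [Nat.succ_eq_add_one] at this
      omega
    · rw [Finset.sum_range_succ]
      have h : ∀ l ∈ Finset.range (M + 1), (l + n).choose n * (M + 1 - l).choose (i + 1)
          = (l + n).choose n * (M - l).choose i + (l + n).choose n * (M - l).choose (i + 1) := by
        intro l hl
        have : M + 1 - l = (M - l) + 1 := by have := Finset.mem_range.1 hl; omega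
        rw [this, Nat.choose_succ_succ]
        ring
      rw [Finset.sum_congr rfl h, Finset.sum_add_distrib, ih i, ih (i + 1)]
      have h1 : M + 1 + n + 1 = (M + n + 1) + 1 := by ring
      have h2 : i + 1 + n + 1 = (i + n + 1) + 1 := by ring
      rw [h1, h2, Nat.choose_succ_succ (M + n + 1) (i + n + 1)]
      simp

/-- The binomial convolutions `∑ b l * (M - l).choose i` determine `b` on `0, …, M`. -/
lemma eq_of_sum_mul_choose_eq {M : ℕ} {a b : ℕ → ℕ}
    (h : ∀ i ≤ M, ∑ l ∈ Finset.range (M + 1), a l * (M - l).choose i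
      = ∑ l ∈ Finset.range (M + 1), b l * (M - l).choose i) :
    ∀ l ≤ M, a l = b l := by
  intro l
  induction l using Nat.strong_induction_on with
  | _ l ih =>
    intro hl
    -- Testing with `i = M - l` kills all terms beyond `l`, so the system is triangular with unit
    -- diagonal.
    have key : ∀ c : ℕ → ℕ, ∑ x ∈ Finset.range (M + 1), c x * (M - x).choose (M - l)
        = ∑ x ∈ Finset.range l, c x * (M - x).choose (M - l) + c l := by
      intro c
      rw [← Finset.sum_range_add_sum_Ico _ (show l ≤ M + 1 by omega),
        Finset.sum_eq_sum_Ico_succ_bot (by omega)]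
      rw [Finset.sum_eq_zero (s := Finset.Ico (l + 1) (M + 1))]
      · simp
      · intro x hx
        rw [Finset.mem_Ico] at hx
        rw [Nat.choose_eq_zero_of_lt (by omega), mul_zero]
    have h1 := h (M - l) (by omega)
    rw [key, key, Finset.sum_congr rfl (g := fun x => b x * (M - x).choose (M - l))] at h1
    · omega
    · intro x hx
      have := Finset.mem_range.1 hx
      rw [ih x this (by omega)]

/-- The two ways of writing a hypergeometric tail. -/
lemma sum_Ico_choose_mul_choose {m N e : ℕ} (he : e < N) (J : ℕ) (hJ : J ≤ m) :
    ∑ p ∈ Finset.Ico J m, p.choose e * (m - 1 - p).choose (N - 1 - e)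
      = ∑ i ∈ Finset.range (e + 1), J.choose i * (m - J).choose (N - i) := by
  -- Both sides count the `N`-subsets of `m` ordered points with at most `e` elements among the
  -- first `J`; on the left they are sorted by the position `p ≥ J` of their element number `e + 1`.
  induction hJ using Nat.decreasingInduction with
  | self =>
    simp only [Finset.Ico_self, Finset.sum_empty, Nat.sub_self]
    symm
    apply Finset.sum_eq_zero
    intro i hi
    have := Finset.mem_range.1 hi
    rw [Nat.choose_eq_zero_of_lt (by omega : 0 < N - i), mul_zero]
  | of_succ J hJ ih =>
    rw [Finset.sum_eq_sum_Ico_succ_bot hJ, ih]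
    obtain ⟨m', rfl⟩ : ∃ m', m = J + 1 + m' := ⟨m - J - 1, by omega⟩
    have e1 : J + 1 + m' - 1 - J = m' := by omega
    have e2 : J + 1 + m' - (J + 1) = m' := by omega
    have e3 : J + 1 + m' - J = m' + 1 := by omega
    rw [e1, e2, e3]
    clear ih hJ e1 e2 e3
    induction e with
    | zero =>
      obtain ⟨N', rfl⟩ : ∃ N', N = N' + 1 := ⟨N - 1, by omega⟩
      simp [Nat.choose_succ_succ]
    | succ e ih =>
      rw [Finset.sum_range_succ _ (e + 1), Finset.sum_range_succ _ (e + 1), ← ih (by omega)]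
      obtain ⟨N', rfl⟩ : ∃ N', N = N' + 1 + (e + 1) := ⟨N - 1 - (e + 1), by omega⟩
      have e1 : N' + 1 + (e + 1) - 1 - (e + 1) = N' := by omega
      have e2 : N' + 1 + (e + 1) - (e + 1) = N' + 1 := by omega
      have e3 : N' + 1 + (e + 1) - 1 - e = N' + 1 := by omega
      rw [e1, e2, e3, Nat.choose_succ_succ J e, Nat.choose_succ_succ m' N']
      simp only [Nat.succ_eq_add_one]
      ring

variable {m n : ℕ}

/-- A violator map of combinatorial dimension `n + 1`: every large set has exactly one basis. -/
def IsViolatorMap (n : ℕ) (viol : Finset (Fin m) → Finset (Fin m)) : Prop :=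
  ∀ S : Finset (Fin m), n + 1 ≤ S.card →
    ∃! D : Finset (Fin m), (D ⊆ S ∧ D.card = n + 1) ∧ Disjoint (viol D) S

lemma IsViolatorMap.disjoint_self {viol : Finset (Fin m) → Finset (Fin m)}
    (h : IsViolatorMap n viol) {D : Finset (Fin m)} (hD : D.card = n + 1) :
    Disjoint (viol D) D := by
  obtain ⟨D', ⟨⟨h1, h2⟩, h3⟩, -⟩ := h D hD.ge
  rwa [Finset.eq_of_subset_of_card_le h1 (by omega)] at h3

lemma IsViolatorMap.card_viol_le {viol : Finset (Fin m) → Finset (Fin m)}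
    (h : IsViolatorMap n viol) {D : Finset (Fin m)} (hD : D.card = n + 1) :
    (viol D).card + (n + 1) ≤ m := by
  have := Finset.card_union_of_disjoint (h.disjoint_self hD)
  have h2 := Finset.card_le_univ (viol D ∪ D)
  simp at h2
  omega

/-- The number of sets of given size whose trace on the disjoint sets `D`, `A` is `D`, `∅`. -/
lemma card_filter_subset_disjoint {D A : Finset (Fin m)} (hDA : Disjoint A D) {N : ℕ}
    (hN : D.card ≤ N) :
    ((Finset.powersetCard N Finset.univ).filter
      (fun S : Finset (Fin m) => D ⊆ S ∧ Disjoint A S)).card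
      = (m - D.card - A.card).choose (N - D.card) := by
  have hc : ((A ∪ D)ᶜ).card = m - D.card - A.card := by
    rw [Finset.card_compl, Finset.card_union_of_disjoint hDA, Fintype.card_fin]; omega
  rw [← hc, ← Finset.card_powersetCard]
  symm
  apply Finset.card_bij (fun R _ => R ∪ D)
  · intro R hR
    rw [Finset.mem_powersetCard] at hR
    have hRD : Disjoint R D := by
      rw [Finset.disjoint_left]; intro x hx hxD
      have := hR.1 hx; simp at this; tauto
    simp only [Finset.mem_filter, Finset.mem_powersetCard, Finset.subset_univ, true_and]
    refine ⟨by rw [Finset.card_union_of_disjoint hRD]; omega, Finset.subset_union_right, ?_⟩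
    rw [Finset.disjoint_union_right]
    refine ⟨?_, hDA⟩
    rw [Finset.disjoint_right]; intro x hx hxA
    have := hR.1 hx; simp at this; tauto
  · intro R hR R' hR' h
    rw [Finset.mem_powersetCard] at hR hR'
    ext x
    have h1 : x ∈ R ∪ D ↔ x ∈ R' ∪ D := by rw [h]
    have h2 : x ∈ R → x ∈ (A ∪ D)ᶜ := fun hx => hR.1 hx
    have h3 : x ∈ R' → x ∈ (A ∪ D)ᶜ := fun hx => hR'.1 hx
    simp at h1 h2 h3
    tauto
  · intro S hS
    simp only [Finset.mem_filter, Finset.mem_powersetCard, Finset.subset_univ, true_and] at hS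
    refine ⟨S \ D, ?_, by simp [hS.2.1]⟩
    rw [Finset.mem_powersetCard, Finset.card_sdiff_of_subset hS.2.1, hS.1]
    refine ⟨?_, rfl⟩
    intro x hx
    have := Finset.disjoint_right.1 hS.2.2 (Finset.mem_sdiff.1 hx).1
    simp at hx ⊢
    tauto

/-- The number of bases with exactly `l` violators does not depend on the violator map. -/
lemma IsViolatorMap.card_filter_eq {viol : Finset (Fin m) → Finset (Fin m)}
    (h : IsViolatorMap n viol) {l : ℕ} (hl : l + (n + 1) ≤ m) :
    ((Finset.powersetCard (n + 1) Finset.univ).filter (fun D => (viol D).card = l)).card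
      = (l + n).choose n := by
  obtain ⟨M, rfl⟩ : ∃ M, m = M + (n + 1) := ⟨m - (n + 1), by omega⟩
  set b : ℕ → ℕ := fun l =>
    ((Finset.powersetCard (n + 1) Finset.univ).filter (fun D => (viol D).card = l)).card with hb
  -- Each set of size `i + n + 1` is counted once, at its unique basis `D`; a given `D` with `l`
  -- violators serves `(M - l).choose i` such sets. These equations determine the counts, and the
  -- convolution identity shows which numbers solve them.
  have key := eq_of_sum_mul_choose_eq (M := M) (a := b) (b := fun l => (l + n).choose n) ?_ l
    (by omega)
  · exact key
  intro i hi
  rw [sum_choose_mul_choose]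
  have h1 : ∑ l ∈ Finset.range (M + 1), b l * (M - l).choose i
      = ∑ D ∈ Finset.powersetCard (n + 1) (Finset.univ : Finset (Fin (M + (n + 1)))),
          (M - (viol D).card).choose i := by
    rw [← Finset.sum_fiberwise_of_maps_to (s := Finset.powersetCard (n + 1) Finset.univ)
      (t := Finset.range (M + 1)) (g := fun D => (viol D).card)]
    · apply Finset.sum_congr rfl
      intro l _
      rw [Finset.sum_congr rfl (g := fun _ => (M - l).choose i), Finset.sum_const, smul_eq_mul]
      intro D hD
      rw [(Finset.mem_filter.1 hD).2]
    · intro D hD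
      have := h.card_viol_le (Finset.mem_powersetCard.1 hD).2
      rw [Finset.mem_range]; omega
  rw [h1]
  have h2 : (M + n + 1).choose (i + n + 1)
      = (Finset.powersetCard (i + n + 1) (Finset.univ : Finset (Fin (M + (n + 1))))).card := by
    rw [Finset.card_powersetCard]; simp [add_assoc]
  rw [h2, Finset.card_eq_sum_ones]
  have h3 : ∀ S ∈ Finset.powersetCard (i + n + 1) (Finset.univ : Finset (Fin (M + (n + 1)))),
      1 = ∑ D ∈ Finset.powersetCard (n + 1) (Finset.univ : Finset (Fin (M + (n + 1)))),
        if D ⊆ S ∧ Disjoint (viol D) S then 1 else 0 := by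
    intro S hS
    rw [Finset.mem_powersetCard] at hS
    obtain ⟨D, hD, hu⟩ := h S (by omega)
    rw [Finset.sum_eq_single D]
    · rw [if_pos ⟨hD.1.1, hD.2⟩]
    · intro D' hD' hne
      rw [if_neg]
      intro hc
      exact hne (hu D' ⟨⟨hc.1, (Finset.mem_powersetCard.1 hD').2⟩, hc.2⟩)
    · intro hn
      exact absurd (Finset.mem_powersetCard.2 ⟨Finset.subset_univ _, hD.1.2⟩) hn
  rw [Finset.sum_congr rfl h3, Finset.sum_comm]
  apply Finset.sum_congr rfl
  intro D hD
  have hD' := (Finset.mem_powersetCard.1 hD).2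
  rw [← Finset.card_filter, card_filter_subset_disjoint (h.disjoint_self hD') (by omega), hD']
  congr 1 <;> omega

/-- Few sets `S` have a basis that, up to `s` violators in `S`, has many violators outside `S`. -/
lemma IsViolatorMap.card_filter_le {viol : Finset (Fin m) → Finset (Fin m)}
    (h : IsViolatorMap n viol) {N s j : ℕ} (hN : s + n + 1 ≤ N) (hj : j + s + n + 1 ≤ m) :
    ((Finset.powersetCard N Finset.univ).filter (fun S => ∃ D ⊆ S, D.card = n + 1 ∧
      (viol D ∩ S).card = s ∧ j + 1 ≤ (viol D \ S).card)).card
    ≤ (s + n).choose s * ∑ i ∈ Finset.range (s + n + 1),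
        (j + s + n + 1).choose i * (m - (j + s + n + 1)).choose (N - i) := by
  obtain ⟨M, rfl⟩ : ∃ M, m = M + (n + 1) := ⟨m - (n + 1), by omega⟩
  set 𝒟 := (Finset.powersetCard (n + 1) (Finset.univ : Finset (Fin (M + (n + 1))))).filter
    (fun D => s + j + 1 ≤ (viol D).card) with h𝒟
  -- `S` is coded by `D` and its violators `W` inside `S`; the remaining violators must avoid `S`.
  -- Several codes may give the same `S`, hence only an upper bound.
  have hsub : (Finset.powersetCard N Finset.univ).filter (fun S => ∃ D ⊆ S, D.card = n + 1 ∧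
      (viol D ∩ S).card = s ∧ j + 1 ≤ (viol D \ S).card) ⊆
      𝒟.biUnion (fun D => (Finset.powersetCard s (viol D)).biUnion (fun W =>
        (Finset.powersetCard N Finset.univ).filter
          (fun S => D ∪ W ⊆ S ∧ Disjoint (viol D \ W) S))) := by
    intro S hS
    rw [Finset.mem_filter] at hS
    obtain ⟨hS, D, hDS, hD, hs, hj'⟩ := hS
    have hcard := Finset.card_sdiff_add_card_inter (viol D) S
    simp only [Finset.mem_biUnion, h𝒟, Finset.mem_filter]
    refine ⟨D, ⟨Finset.mem_powersetCard.2 ⟨Finset.subset_univ _, hD⟩, by omega⟩, viol D ∩ S,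
      Finset.mem_powersetCard.2 ⟨Finset.inter_subset_left, hs⟩, hS,
      Finset.union_subset hDS Finset.inter_subset_right, ?_⟩
    rw [Finset.disjoint_left]
    intro x hx hxS
    simp at hx
    tauto
  have hterm : ∀ D ∈ 𝒟, ∀ W ∈ Finset.powersetCard s (viol D),
      ((Finset.powersetCard N Finset.univ).filter
          (fun S => D ∪ W ⊆ S ∧ Disjoint (viol D \ W) S)).card
        = (M - (viol D).card).choose (N - s - (n + 1)) := by
    intro D hD W hW
    have hD' := (Finset.mem_powersetCard.1 (Finset.mem_filter.1 hD).1).2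
    rw [Finset.mem_powersetCard] at hW
    have hdis := h.disjoint_self hD'
    have hWD : Disjoint D W := (Finset.disjoint_of_subset_left hW.1 hdis).symm
    have hu : (D ∪ W).card = n + 1 + s := by
      rw [Finset.card_union_of_disjoint hWD]; omega
    have hv : (viol D \ W).card = (viol D).card - s := by
      rw [Finset.card_sdiff_of_subset hW.1, hW.2]
    have hle : s ≤ (viol D).card := hW.2 ▸ Finset.card_le_card hW.1
    rw [card_filter_subset_disjoint _ (by omega), hu, hv]
    · congr 1 <;> omega
    · rw [Finset.disjoint_union_right]
      exact ⟨Finset.disjoint_of_subset_left Finset.sdiff_subset hdis, Finset.sdiff_disjoint⟩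
  calc _ ≤ _ := Finset.card_le_card hsub
    _ ≤ ∑ D ∈ 𝒟, ∑ W ∈ Finset.powersetCard s (viol D),
          ((Finset.powersetCard N Finset.univ).filter
          (fun S => D ∪ W ⊆ S ∧ Disjoint (viol D \ W) S)).card :=
        Finset.card_biUnion_le.trans (Finset.sum_le_sum fun D _ => Finset.card_biUnion_le)
    _ = ∑ D ∈ 𝒟, (viol D).card.choose s * (M - (viol D).card).choose (N - s - (n + 1)) := by
        apply Finset.sum_congr rfl
        intro D hD
        rw [Finset.sum_congr rfl (hterm D hD), Finset.sum_const, smul_eq_mul,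
          Finset.card_powersetCard]
    _ = ∑ l ∈ Finset.Ico (s + j + 1) (M + 1), (l + n).choose n *
          (l.choose s * (M - l).choose (N - s - (n + 1))) := by
        rw [← Finset.sum_fiberwise_of_maps_to (s := 𝒟)
          (t := Finset.Ico (s + j + 1) (M + 1)) (g := fun D => (viol D).card)]
        · apply Finset.sum_congr rfl
          intro l hl
          rw [Finset.mem_Ico] at hl
          rw [Finset.sum_congr rfl
            (g := fun _ => l.choose s * (M - l).choose (N - s - (n + 1))), Finset.sum_const,
            smul_eq_mul]
          · rw [← h.card_filter_eq (l := l) (by omega)]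
            congr 2
            ext D
            simp only [h𝒟, Finset.mem_filter]
            constructor
            · rintro ⟨⟨h1, h2⟩, h3⟩; exact ⟨h1, h3⟩
            · rintro ⟨h1, h3⟩; exact ⟨⟨h1, by omega⟩, h3⟩
          · intro D hD
            rw [(Finset.mem_filter.1 hD).2]
        · intro D hD
          have hD' := Finset.mem_filter.1 hD
          have := h.card_viol_le (Finset.mem_powersetCard.1 hD'.1).2
          rw [Finset.mem_Ico]; omega
    _ = (s + n).choose s * ∑ l ∈ Finset.Ico (s + j + 1) (M + 1), (l + n).choose (s + n) *
          (M - l).choose (N - s - (n + 1)) := by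
        rw [Finset.mul_sum]
        apply Finset.sum_congr rfl
        intro l hl
        -- Choosing `n` and then `s` of `l + n` points amounts to choosing `s + n` and splitting
        -- them; this makes the factor `(s + n).choose s` independent of `l`.
        have h1 := Nat.choose_mul (n := l + n) (k := s + n) (s := n) (by omega)
        rw [Nat.add_sub_cancel, Nat.add_sub_cancel, ← Nat.choose_symm_add (a := s)] at h1
        rw [← mul_assoc, ← h1]
        ring
    _ = _ := by
        -- The substitution `p = l + n` turns the sum into the hypergeometric tail with `e = s + n`.
        rw [← sum_Ico_choose_mul_choose (by omega) _ hj]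
        congr 1
        have h1 : j + s + n + 1 = s + j + 1 + n := by ring
        have h2 : M + (n + 1) = M + 1 + n := by ring
        rw [h1, h2, ← Finset.sum_Ico_add' _ (s + j + 1) (M + 1) n]
        apply Finset.sum_congr rfl
        intro l hl
        congr 2 <;> omega

end Counting

end SeqRand

namespace SeqRand

/-! ### From generic LP-type problems to violator maps, with tie-breaking by index. -/

section LPType

variable {m : ℕ}

/-- An LP-type problem of combinatorial dimension at most `d`, given by the optimal values of its
subproblems, in which different minimal bases have different values. -/
structure IsGenericLPType (d : ℕ) (w : Finset (Fin m) → ℝ) : Prop where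
  mono : Monotone w
  locality : ∀ ⦃S R : Finset (Fin m)⦄ (x : Fin m), S ⊆ R → w S = w R →
    w (insert x S) = w S → w (insert x R) = w R
  dim : ∀ S, ∃ B ⊆ S, B.card ≤ d ∧ w B = w S
  generic : ∀ B B', (∀ i ∈ B, w (B.erase i) < w B) → (∀ i ∈ B', w (B'.erase i) < w B') →
    w B = w B' → B = B'

variable {d : ℕ} {w : Finset (Fin m) → ℝ}

lemma exists_minimal_subset (hw : Monotone w) (S : Finset (Fin m)) :
    ∃ B ⊆ S, w B = w S ∧ ∀ i ∈ B, w (B.erase i) < w B := by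
  obtain ⟨B, hB, hmin⟩ := Finset.exists_min_image (S.powerset.filter (fun B => w B = w S))
    Finset.card ⟨S, by simp⟩
  rw [Finset.mem_filter, Finset.mem_powerset] at hB
  refine ⟨B, hB.1, hB.2, fun i hi => lt_of_le_of_ne (hw (Finset.erase_subset _ _)) fun h => ?_⟩
  have := hmin (B.erase i) (Finset.mem_filter.2
    ⟨Finset.mem_powerset.2 ((Finset.erase_subset _ _).trans hB.1), h.trans hB.2⟩)
  have := Finset.card_erase_lt_of_mem hi
  omega

namespace IsGenericLPType

/-- Shrinking any subset of the same value to a minimal one always ends, by `generic`, in the same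
set, which therefore lies in all of them. Starting from the small set given by `dim` bounds its
size. -/
lemma exists_basis (h : IsGenericLPType d w) (S : Finset (Fin m)) :
    ∃ B ⊆ S, B.card ≤ d ∧ w B = w S ∧ ∀ B' ⊆ S, w B' = w S → B ⊆ B' := by
  obtain ⟨B₀, hB₀, hd, hw₀⟩ := h.dim S
  obtain ⟨B, hB, hw, hmin⟩ := exists_minimal_subset h.mono B₀
  refine ⟨B, hB.trans hB₀, (Finset.card_le_card hB).trans hd, hw.trans hw₀, fun B' _ hw' => ?_⟩
  obtain ⟨B'', hB'', hw'', hmin'⟩ := exists_minimal_subset h.mono B'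
  rw [h.generic B B'' hmin hmin' (by rw [hw, hw₀, hw'', hw'])]
  exact hB''

/-- The smallest subproblem with the same optimal value. -/
noncomputable def basis (h : IsGenericLPType d w) (S : Finset (Fin m)) : Finset (Fin m) :=
  (h.exists_basis S).choose

variable (h : IsGenericLPType d w)
include h

lemma basis_subset (S) : h.basis S ⊆ S := (h.exists_basis S).choose_spec.1

lemma card_basis_le (S) : (h.basis S).card ≤ d := (h.exists_basis S).choose_spec.2.1

lemma value_basis (S) : w (h.basis S) = w S := (h.exists_basis S).choose_spec.2.2.1

lemma basis_subset_of_eq {S B : Finset (Fin m)} (hB : B ⊆ S) (hw : w B = w S) : h.basis S ⊆ B :=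
  (h.exists_basis S).choose_spec.2.2.2 B hB hw

lemma basis_eq_of_eq {S R : Finset (Fin m)} (hS : S ⊆ R) (hw : w S = w R) :
    h.basis S = h.basis R := by
  have h1 : h.basis R ⊆ h.basis S := h.basis_subset_of_eq ((h.basis_subset S).trans hS)
    ((h.value_basis S).trans hw)
  exact (h.basis_subset_of_eq (h1.trans (h.basis_subset S))
    ((h.value_basis R).trans hw.symm)).antisymm h1

lemma value_eq_of_forall_insert {D S : Finset (Fin m)} (hD : D ⊆ S)
    (hx : ∀ x ∈ S, w (insert x D) = w D) : w D = w S := by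
  have key : ∀ A : Finset (Fin m), A ⊆ S → w (A ∪ D) = w D := by
    intro A
    induction A using Finset.induction_on with
    | empty => simp
    | insert x A hxA ih =>
      intro hA
      have h1 := ih ((Finset.subset_insert _ _).trans hA)
      rw [Finset.insert_union, ← h1]
      exact h.locality x Finset.subset_union_right h1.symm (hx x (hA (Finset.mem_insert_self _ _)))
  rw [← key S subset_rfl, Finset.union_eq_left.2 hD]

open Classical in
/-- The violators of `D`; the elements of `D` outside of its basis are regarded as tight for the
order of the indices. -/
noncomputable def violators (D : Finset (Fin m)) : Finset (Fin m) :=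
  Finset.univ.filter (fun x => x ∉ D ∧ (w D < w (insert x D) ∨ ∃ y ∈ D \ h.basis D, x < y))

lemma mem_violators {D : Finset (Fin m)} {x : Fin m} : x ∈ h.violators D ↔
    x ∉ D ∧ (w D < w (insert x D) ∨ ∃ y ∈ D \ h.basis D, x < y) := by
  simp [violators]

/-- The basis may have fewer than `d` elements; it is padded with elements of least total index. A
violator in `S` would either raise the value beyond that of `S` or could replace a padding element
of larger index. -/
lemma exists_padded_basis {S : Finset (Fin m)} (hS : d ≤ S.card) :
    ∃ D ⊆ S, D.card = d ∧ Disjoint (h.violators D) S ∧ w D = w S := by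
  obtain ⟨D₀, hD₀, hD₀S, hD₀d⟩ := Finset.exists_subsuperset_card_eq (h.basis_subset S)
    (h.card_basis_le S) hS
  obtain ⟨D, hD, hmin⟩ := Finset.exists_min_image
    ((S.powersetCard d).filter (fun D => h.basis S ⊆ D)) (fun D => ∑ i ∈ D, (i : ℕ))
    ⟨D₀, Finset.mem_filter.2 ⟨Finset.mem_powersetCard.2 ⟨hD₀S, hD₀d⟩, hD₀⟩⟩
  rw [Finset.mem_filter, Finset.mem_powersetCard] at hD
  obtain ⟨⟨hDS, hDd⟩, hBD⟩ := hD
  have hwD : w D = w S := le_antisymm (h.mono hDS) ((h.value_basis S).symm.le.trans (h.mono hBD))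
  refine ⟨D, hDS, hDd, ?_, hwD⟩
  rw [Finset.disjoint_right]
  intro x hxS hx
  rw [h.mem_violators] at hx
  obtain ⟨hxD, hx | ⟨y, hy, hxy⟩⟩ := hx
  · exact absurd (h.mono (Finset.insert_subset hxS hDS)) (by rw [← hwD]; exact not_le.2 hx)
  · rw [Finset.mem_sdiff, h.basis_eq_of_eq hDS hwD] at hy
    have h1 := hmin (insert x (D.erase y)) (Finset.mem_filter.2 ⟨Finset.mem_powersetCard.2 ⟨?_, ?_⟩,
      ?_⟩)
    · rw [Finset.sum_insert (fun hc => hxD (Finset.mem_of_mem_erase hc))] at h1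
      have h2 := Finset.add_sum_erase D (fun i : Fin m => (i : ℕ)) hy.1
      have : (x : ℕ) < y := hxy
      omega
    · exact Finset.insert_subset hxS ((Finset.erase_subset _ _).trans hDS)
    · rw [Finset.card_insert_of_notMem (fun hc => hxD (Finset.mem_of_mem_erase hc)),
        Finset.card_erase_add_one hy.1, hDd]
    · intro z hz
      exact Finset.mem_insert_of_mem (Finset.mem_erase.2 ⟨fun hc => hy.2 (hc ▸ hz), hBD hz⟩)

lemma value_eq_of_disjoint_violators {D S : Finset (Fin m)} (hD : D ⊆ S)
    (hv : Disjoint (h.violators D) S) : w D = w S := by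
  apply h.value_eq_of_forall_insert hD
  intro x hx
  by_cases hxD : x ∈ D
  · rw [Finset.insert_eq_of_mem hxD]
  · have := Finset.disjoint_right.1 hv hx
    rw [h.mem_violators] at this
    push Not at this
    exact le_antisymm (this hxD).1 (h.mono (Finset.subset_insert _ _))

/-- Both sets have the basis of `S`, so elements in which they differ are padding. Of two such
elements, one from each side, neither may precede the other. -/
lemma subset_of_disjoint_violators {D D' S : Finset (Fin m)} (hD : D ⊆ S) (hD' : D' ⊆ S)
    (hv : Disjoint (h.violators D) S) (hv' : Disjoint (h.violators D') S)
    (hc : D.card = D'.card) : D ⊆ D' := by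
  have hB := h.basis_eq_of_eq hD (h.value_eq_of_disjoint_violators hD hv)
  have hB' := h.basis_eq_of_eq hD' (h.value_eq_of_disjoint_violators hD' hv')
  by_contra hsub
  obtain ⟨x, hx, hx'⟩ := Finset.not_subset.1 hsub
  obtain ⟨y, hy', hy⟩ : ∃ y ∈ D', y ∉ D := by
    apply Finset.not_subset.1
    intro hs
    rw [Finset.eq_of_subset_of_card_le hs hc.le] at hx'
    exact hx' hx
  have h1 := Finset.disjoint_right.1 hv (hD' hy')
  have h2 := Finset.disjoint_right.1 hv' (hD hx)
  rw [h.mem_violators] at h1 h2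
  push Not at h1 h2
  have h3 := (h1 hy).2 x (by
    rw [Finset.mem_sdiff, hB, ← hB']
    exact ⟨hx, fun hc => hx' (h.basis_subset _ hc)⟩)
  have h4 := (h2 hx').2 y (by
    rw [Finset.mem_sdiff, hB', ← hB]
    exact ⟨hy', fun hc => hy (h.basis_subset _ hc)⟩)
  exact hx' (le_antisymm h3 h4 ▸ hy')

/-- A subproblem of fixed size that is optimal in a family closed under exchanges is violated by all
the discarded constraints. -/
lemma exists_padded_basis_violated (hd : 0 < d) {S : Finset (Fin m)}
    {𝒥 : Finset (Finset (Fin m))} (h𝒥 : 𝒥.Nonempty) (hcard : ∀ J ∈ 𝒥, d ≤ J.card)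
    (hex : ∀ J ∈ 𝒥, ∀ x ∈ S \ J, ∀ y ∈ J, w (insert x J) = w J → (insert x J).erase y ∈ 𝒥) :
    ∃ J ∈ 𝒥, ∃ D ⊆ J, D.card = d ∧ Disjoint (h.violators D) J ∧ S \ J ⊆ h.violators D ∧
      ∀ x, w J < w (insert x J) → x ∈ h.violators D := by
  -- `J` has the least value and, among those, the largest index sum. If a discarded `x` were not a
  -- violator, exchanging it for some `y ∈ D` would contradict this choice.
  obtain ⟨J₁, hJ₁, hmin₁⟩ := Finset.exists_min_image 𝒥 w h𝒥
  obtain ⟨J, hJ, hmax⟩ := Finset.exists_max_image (𝒥.filter (fun J => w J = w J₁))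
    (fun J => ∑ i ∈ J, (i : ℕ)) ⟨J₁, Finset.mem_filter.2 ⟨hJ₁, rfl⟩⟩
  rw [Finset.mem_filter] at hJ
  obtain ⟨hJ, hwJ⟩ := hJ
  obtain ⟨D, hDJ, hDd, hv, hwD⟩ := h.exists_padded_basis (hcard J hJ)
  refine ⟨J, hJ, D, hDJ, hDd, hv, ?_, ?_⟩
  · intro x hx
    by_contra hxv
    have hxJ := (Finset.mem_sdiff.1 hx).2
    rw [h.mem_violators] at hxv
    push Not at hxv
    obtain ⟨hx1, hx2⟩ := hxv (fun hc => hxJ (hDJ hc))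
    have hwx : w (insert x J) = w J := h.locality x hDJ hwD
      (le_antisymm hx1 (h.mono (Finset.subset_insert _ _)))
    obtain ⟨y, hy⟩ : D.Nonempty := Finset.card_pos.1 (by omega)
    have hJ₂ := hex J hJ x hx y (hDJ hy) hwx
    have hle : w ((insert x J).erase y) ≤ w J := hwx ▸ h.mono (Finset.erase_subset _ _)
    have heq : w ((insert x J).erase y) = w J :=
      le_antisymm hle (hwJ ▸ hmin₁ _ hJ₂)
    -- Minimality forces the exchange to preserve the value, so `y` cannot belong to the basis of
    -- `insert x J`. If `y` is padding, then `y < x` and the exchange raises the index sum.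
    by_cases hyB : y ∈ h.basis D
    · rw [h.basis_eq_of_eq (hDJ.trans (Finset.subset_insert x J)) (hwD.trans hwx.symm)] at hyB
      exact Finset.notMem_erase y _
        (h.basis_subset_of_eq (Finset.erase_subset _ _) (heq.trans hwx.symm) hyB)
    · have hyx := hx2 y (Finset.mem_sdiff.2 ⟨hy, hyB⟩)
      have hne : y ≠ x := fun hc => hxJ (hc ▸ hDJ hy)
      have h1 := hmax _ (Finset.mem_filter.2 ⟨hJ₂, heq.trans hwJ⟩)
      have h2 := Finset.add_sum_erase (insert x J) (fun i : Fin m => (i : ℕ))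
        (Finset.mem_insert_of_mem (hDJ hy))
      rw [Finset.sum_insert hxJ] at h2
      have h3 : (y : ℕ) < x := lt_of_le_of_ne hyx (fun hc => hne (Fin.ext hc))
      omega
  · intro x hx
    rw [h.mem_violators]
    refine ⟨fun hc => ?_, Or.inl ?_⟩
    · rw [Finset.insert_eq_of_mem (hDJ hc)] at hx
      exact lt_irrefl _ hx
    · refine lt_of_le_of_ne (h.mono (Finset.subset_insert _ _)) fun hc => ?_
      rw [h.locality x hDJ hwD hc.symm] at hx
      exact lt_irrefl _ hx

end IsGenericLPType

lemma IsGenericLPType.isViolatorMap {n : ℕ} (h : IsGenericLPType (n + 1) w) :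
    IsViolatorMap n h.violators := by
  intro S hS
  obtain ⟨D, hDS, hDd, hv, -⟩ := h.exists_padded_basis hS
  refine ⟨D, ⟨⟨hDS, hDd⟩, hv⟩, ?_⟩
  rintro D' ⟨⟨hD'S, hD'd⟩, hv'⟩
  exact (h.subset_of_disjoint_violators hD'S hDS hv' hv (by omega)).antisymm
    (h.subset_of_disjoint_violators hDS hD'S hv hv' (by omega))

end LPType

end SeqRand

namespace SeqRand

/-! ### Generic perturbation of strictly convex programs. -/

section Relaxation

open Filter Topology

/-- A vector of small positive numbers can avoid finitely many conditions each of which, in some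
coordinate, can hold for at most one value. -/
lemma exists_pos_forall_not_bad {m : ℕ} {ι : Type*} (I : Finset ι) (bad : ι → (Fin m → ℝ) → Prop)
    (c : ι → Fin m) (hbad : ∀ b ∈ I, ∀ v v', bad b v → bad b v' → (∀ j ≠ c b, v j = v' j) →
      v (c b) = v' (c b)) {r : ℝ} (hr : 0 < r) :
    ∃ v : Fin m → ℝ, (∀ j, 0 < v j ∧ v j ≤ r) ∧ ∀ b ∈ I, ¬ bad b v := by
  classical
  -- On a grid with `L` values per coordinate each condition excludes at most `L ^ (m - 1)` of the
  -- `L ^ m` points, and there are fewer than `L` conditions.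
  set L := I.card + 1 with hL
  have hLpos : (0 : ℝ) < L := by positivity
  let g : (Fin m → Fin L) → (Fin m → ℝ) := fun a j => r * ((a j : ℕ) + 1) / L
  have ginj : ∀ (x y : Fin L), r * ((x : ℕ) + 1) / L = r * ((y : ℕ) + 1) / (L : ℝ) → x = y := by
    intro x y h
    field_simp at h
    have : ((x : ℕ) : ℝ) = (y : ℕ) := by linarith
    exact Fin.ext (by exact_mod_cast this)
  by_contra hcon
  push Not at hcon
  have hcover : (Finset.univ : Finset (Fin m → Fin L)) ⊆
      I.biUnion (fun b => Finset.univ.filter (fun a => bad b (g a))) := by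
    intro a _
    obtain ⟨b, hb, hba⟩ := hcon (g a) (by
      intro j
      refine ⟨by positivity, ?_⟩
      simp only [g]
      rw [div_le_iff₀ hLpos]
      apply mul_le_mul_of_nonneg_left _ hr.le
      exact_mod_cast (a j).2)
    simp only [Finset.mem_biUnion, Finset.mem_filter, Finset.mem_univ, true_and]
    exact ⟨b, hb, hba⟩
  have hone : ∀ b ∈ I, (Finset.univ.filter (fun a => bad b (g a))).card ≤ L ^ (m - 1) := by
    intro b hb
    have : Fintype.card ({j : Fin m // j ≠ c b} → Fin L) = L ^ (m - 1) := by
      simp [Fintype.card_subtype_compl]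
    rw [← this, ← Finset.card_univ]
    apply Finset.card_le_card_of_injOn (fun a j => a j.1) (fun _ _ => Finset.mem_coe.2 (Finset.mem_univ _))
    intro a ha a' ha' h
    simp only [Finset.coe_filter, Finset.mem_univ, true_and, Set.mem_ofPred_eq] at ha ha'
    have h1 : ∀ j ≠ c b, a j = a' j := fun j hj => congrFun h ⟨j, hj⟩
    have h2 := hbad b hb _ _ ha ha' (fun j hj => by simp only [g]; rw [h1 j hj])
    funext j
    by_cases hj : j = c b
    · subst hj; exact ginj _ _ h2
    · exact h1 j hj
  have h1 := Finset.card_le_card hcover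
  have h2 := h1.trans Finset.card_biUnion_le
  have h3 := h2.trans (Finset.sum_le_sum hone)
  rw [Finset.sum_const, smul_eq_mul, Finset.card_univ, Fintype.card_fun, Fintype.card_fin,
    Fintype.card_fin] at h3
  rcases Nat.eq_zero_or_pos m with rfl | hm
  · obtain ⟨b, -, -⟩ := hcon (fun _ => r) (fun j => ⟨hr, le_rfl⟩)
    exact (c b).elim0
  · have h4 : L ^ m = L * L ^ (m - 1) := by rw [← pow_succ']; congr 1; omega
    rw [h4] at h3
    have h5 := Nat.le_of_mul_le_mul_right h3 (by positivity)
    omega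

variable {F : Type*} [NormedAddCommGroup F] [NormedSpace ℝ F] [FiniteDimensional ℝ F] {m : ℕ}

/-- By Helly's theorem the optimal value of a convex program is attained on few constraints. -/
lemma exists_subset_card_le_value_eq {G : F → ℝ} (hG : ConvexOn ℝ Set.univ G) {K : Fin m → Set F}
    (hK : ∀ i, Convex ℝ (K i)) (z : Finset (Fin m) → F) (hz : ∀ S, ∀ i ∈ S, z S ∈ K i)
    (hmin : ∀ S z', (∀ i ∈ S, z' ∈ K i) → G (z S) ≤ G z') (S : Finset (Fin m)) :
    ∃ B ⊆ S, B.card ≤ Module.finrank ℝ F ∧ G (z B) = G (z S) := by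
  classical
  by_contra hcon
  push Not at hcon
  have hlt : ∀ B ⊆ S, B.card ≤ Module.finrank ℝ F → G (z B) < G (z S) := fun B hB hc =>
    lt_of_le_of_ne (hmin B _ fun i hi => hz S i (hB hi)) (hcon B hB hc)
  -- The strict sublevel set at the optimum of `S` joins the constraints, with index `none`. If all
  -- small subproblems had smaller optimum, Helly's theorem would give a feasible point below the
  -- optimum.
  let 𝒦 : Option (Fin m) → Set F := fun o => o.elim {y | G y < G (z S)} K
  have key : (⋂ o ∈ Finset.insertNone S, 𝒦 o).Nonempty := by
    apply Convex.helly_theorem' (𝕜 := ℝ)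
    · rintro (_ | i) _
      · have h := hG.convex_lt (G (z S))
        simp only [Set.mem_univ, true_and] at h
        exact h
      · exact hK i
    · intro I hI hIc
      by_cases hn : none ∈ I
      · refine ⟨z (Finset.eraseNone I), ?_⟩
        have hc : (Finset.eraseNone I).card + 1 = I.card := by
          rw [← Finset.card_erase_add_one hn, ← Finset.map_some_eraseNone, Finset.card_map]
        have hsub : Finset.eraseNone I ⊆ S := by
          intro i hi
          rw [Finset.mem_eraseNone] at hi
          simpa using hI hi
        simp only [Set.mem_iInter]
        rintro (_ | i) ho
        · exact hlt _ hsub (by omega)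
        · exact hz _ i (Finset.mem_eraseNone.2 ho)
      · refine ⟨z S, ?_⟩
        simp only [Set.mem_iInter]
        rintro (_ | i) ho
        · exact absurd ho hn
        · exact hz S i (by simpa using hI ho)
  obtain ⟨y, hy⟩ := key
  simp only [Set.mem_iInter] at hy
  have h1 : G y < G (z S) := hy none (by simp)
  exact absurd (hmin S y fun i hi => hy (some i) (by simpa using hi)) (not_le.2 h1)

/-- Small perturbations of the right-hand sides make a strictly convex program generic. -/
lemma exists_isGenericLPType {G : F → ℝ} (hG : StrictConvexOn ℝ Set.univ G) (hGc : Continuous G)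
    (hGt : Tendsto G (cocompact F) atTop) {φ : Fin m → F → ℝ}
    (hφ : ∀ i, ConvexOn ℝ Set.univ (φ i)) (hφc : ∀ i, Continuous (φ i))
    (hfeas : ∃ y, ∀ i, φ i y ≤ 0) {r : ℝ} (hr : 0 < r) :
    ∃ η : Fin m → ℝ, (∀ i, 0 < η i ∧ η i ≤ r) ∧ ∃ z : Finset (Fin m) → F,
      (∀ S, ∀ i ∈ S, φ i (z S) ≤ η i) ∧
      (∀ S z', (∀ i ∈ S, φ i z' ≤ η i) → G (z S) ≤ G z') ∧
      IsGenericLPType (Module.finrank ℝ F) (fun S => G (z S)) := by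
  classical
  obtain ⟨y₀, hy₀⟩ := hfeas
  have hex : ∀ (η : Fin m → ℝ) (S : Finset (Fin m)), ∃ z, (∀ i, 0 < η i) →
      (∀ i ∈ S, φ i z ≤ η i) ∧ ∀ z', (∀ i ∈ S, φ i z' ≤ η i) → G z ≤ G z' := by
    intro η S
    by_cases hη : ∀ i, 0 < η i
    · have hcl : IsClosed {z | ∀ i ∈ S, φ i z ≤ η i} := by
        simp only [Set.ofPred_forall]
        exact isClosed_biInter fun i _ => isClosed_le (hφc i) continuous_const
      obtain ⟨z, hz, hmin⟩ := hGc.continuousOn.exists_isMinOn' hcl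
        (x₀ := y₀) (fun i _ => (hy₀ i).trans (hη i).le)
        ((hGt.eventually_ge_atTop (G y₀)).filter_mono inf_le_left)
      exact ⟨z, fun _ => ⟨hz, fun z' hz' => hmin hz'⟩⟩
    · exact ⟨y₀, fun h => absurd h hη⟩
  choose z hz using hex
  have huniq : ∀ (η : Fin m → ℝ) (S : Finset (Fin m)) (y : F), (∀ i, 0 < η i) →
      (∀ i ∈ S, φ i y ≤ η i) → G y ≤ G (z η S) → y = z η S := by
    intro η S y hη hy hle
    have hconv : Convex ℝ {z | ∀ i ∈ S, φ i z ≤ η i} := by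
      simp only [Set.ofPred_forall]
      exact convex_iInter₂ fun i _ => by simpa using (hφ i).convex_le (η i)
    have hmin := hz η S hη
    exact (hG.subset (Set.subset_univ _) hconv).eq_of_isMinOn
      (fun y' hy' => hle.trans (hmin.2 y' hy')) (fun y' hy' => hmin.2 y' hy') hy hmin.1
  have hmono : ∀ η, (∀ i, 0 < η i) → Monotone (fun S => G (z η S)) := fun η hη S R hSR =>
    (hz η S hη).2 _ fun i hi => (hz η R hη).1 i (hSR hi)
  have hcongr : ∀ (η η' : Fin m → ℝ) (S : Finset (Fin m)), (∀ i, 0 < η i) → (∀ i, 0 < η' i) →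
      (∀ i ∈ S, η i = η' i) → G (z η S) = G (z η' S) := fun η η' S hη hη' h =>
    le_antisymm ((hz η S hη).2 _ fun i hi => (h i hi).symm ▸ (hz η' S hη').1 i hi)
      ((hz η' S hη').2 _ fun i hi => h i hi ▸ (hz η S hη).1 i hi)
  -- relaxing an essential constraint strictly decreases the optimal value
  have hstrict : ∀ (η η' : Fin m → ℝ) (B : Finset (Fin m)) (i : Fin m), (∀ i, 0 < η i) →
      (∀ i, 0 < η' i) → (∀ j ≠ i, η j = η' j) → η i < η' i →
      G (z η' (B.erase i)) < G (z η' B) → G (z η' B) < G (z η B) := by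
    intro η η' B i hη hη' heq hlt hess
    set y := z η B with hy
    set y' := z η' (B.erase i) with hy'
    have hyB := (hz η B hη).1
    have hy'B := (hz η' (B.erase i) hη').1
    have hyf : ∀ j ∈ B, φ j y ≤ η' j := fun j hj => by
      by_cases hji : j = i
      · subst hji; exact (hyB j hj).trans hlt.le
      · exact heq j hji ▸ hyB j hj
    have hGlt : G y' < G y := hess.trans_le ((hz η' B hη').2 y hyf)
    by_cases hi : i ∈ B
    swap
    · rw [hy', Finset.erase_eq_of_notMem hi] at hess
      exact absurd hess (lt_irrefl _)
    -- Sliding slightly from `y` towards the better point `y'`, which ignores constraint `i`, uses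
    -- the slack between `η i` and `η' i` and keeps the other constraints by convexity.
    have hcont : Continuous fun τ : ℝ => φ i ((1 - τ) • y + τ • y') :=
      (hφc i).comp (by fun_prop)
    have hev : ∀ᶠ τ in 𝓝 (0 : ℝ), φ i ((1 - τ) • y + τ • y') < η' i := by
      apply hcont.continuousAt.eventually_lt continuousAt_const
      simpa using (hyB i hi).trans_lt hlt
    obtain ⟨τ, ⟨hτ, hτ1⟩, hτ0⟩ := (((hev.filter_mono nhdsWithin_le_nhds).and
      ((eventually_lt_nhds (zero_lt_one' ℝ)).filter_mono nhdsWithin_le_nhds)).and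
      (self_mem_nhdsWithin (s := Set.Ioi (0 : ℝ)))).exists
    have hτ0' : (0 : ℝ) < τ := hτ0
    have hcomb : ∀ j ∈ B, φ j ((1 - τ) • y + τ • y') ≤ η' j := by
      intro j hj
      by_cases hji : j = i
      · subst hji; exact hτ.le
      · have h1 := (hφ j).2 (Set.mem_univ y) (Set.mem_univ y') (sub_nonneg.2 hτ1.le) hτ0'.le
          (by ring)
        have h2 := hyf j hj
        have h3 := hy'B j (Finset.mem_erase.2 ⟨hji, hj⟩)
        simp only [smul_eq_mul] at h1
        nlinarith
    have h1 := (hz η' B hη').2 _ hcomb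
    have h2 := hG.convexOn.2 (Set.mem_univ y) (Set.mem_univ y') (sub_nonneg.2 hτ1.le) hτ0'.le
      (by ring)
    simp only [smul_eq_mul] at h2
    nlinarith
  -- Bad coincidence: `i` is essential for `B`, absent from `B'`, and both values agree. Changing `η
  -- i` alone fixes the value of `B'` but strictly moves that of `B`, so at most one value of `η i`
  -- is bad.
  let I : Finset (Finset (Fin m) × Finset (Fin m) × Fin m) :=
    Finset.univ.filter (fun b => b.2.2 ∉ b.2.1)
  obtain ⟨η, hη, hgood⟩ := exists_pos_forall_not_bad I
    (fun b η => (∀ i, 0 < η i) ∧ G (z η (b.1.erase b.2.2)) < G (z η b.1) ∧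
      G (z η b.1) = G (z η b.2.1)) (fun b => b.2.2) (by
    rintro ⟨B, B', i⟩ hb
    have hb' : i ∉ B' := (Finset.mem_filter.1 hb).2
    have aux : ∀ v v' : Fin m → ℝ, (∀ i, 0 < v i) → (∀ i, 0 < v' i) →
        G (z v' (B.erase i)) < G (z v' B) → G (z v B) = G (z v B') → G (z v' B) = G (z v' B') →
        (∀ j ≠ i, v j = v' j) → v i < v' i → False := by
      intro v v' hv hv' hess h1 h2 heq hlt
      have h3 := hstrict v v' B i hv hv' heq hlt hess
      rw [h1, h2, hcongr v v' B' hv hv' fun j hj => heq j fun hc => hb' (hc ▸ hj)] at h3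
      exact lt_irrefl _ h3
    rintro v v' ⟨hv, hess, h1⟩ ⟨hv', hess', h2⟩ heq
    rcases lt_trichotomy (v i) (v' i) with h | h | h
    · exact (aux v v' hv hv' hess' h1 h2 heq h).elim
    · exact h
    · exact (aux v' v hv' hv hess h2 h1 (fun j hj => (heq j hj).symm) h).elim) hr
  have hη' : ∀ i, 0 < η i := fun i => (hη i).1
  refine ⟨η, hη, z η, fun S => (hz η S hη').1, fun S => (hz η S hη').2, hmono η hη', ?_, ?_, ?_⟩
  · intro S R x hSR heq hins
    -- Strict convexity makes minimisers unique, so nested problems of equal value share their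
    -- minimiser; this gives locality.
    have h1 : z η R = z η S := huniq η S _ hη' (fun i hi => (hz η R hη').1 i (hSR hi)) heq.ge
    have h2 : z η (insert x S) = z η S := huniq η S _ hη'
      (fun i hi => (hz η _ hη').1 i (Finset.mem_insert_of_mem hi)) hins.le
    refine le_antisymm ((hz η _ hη').2 _ fun i hi => ?_) (hmono η hη' (Finset.subset_insert _ _))
    rcases Finset.mem_insert.1 hi with rfl | hi
    · rw [h1, ← h2]; exact (hz η _ hη').1 i (Finset.mem_insert_self _ _)
    · exact (hz η R hη').1 i hi
  · intro S
    exact exists_subset_card_le_value_eq hG.convexOn (K := fun i => {y | φ i y ≤ η i})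
      (fun i => by simpa using (hφ i).convex_le (η i)) (z η) (hz η · hη' |>.1) (hz η · hη' |>.2) S
  · intro B B' hB hB' heq
    by_contra hne
    have : ∃ i, (i ∈ B ∧ i ∉ B') ∨ (i ∈ B' ∧ i ∉ B) := by
      by_contra hc
      push Not at hc
      exact hne (Finset.ext fun i => ⟨(hc i).1, (hc i).2⟩)
    obtain ⟨i, ⟨h1, h2⟩ | ⟨h1, h2⟩⟩ := this
    · exact hgood (B, B', i) (Finset.mem_filter.2 ⟨Finset.mem_univ _, h2⟩) ⟨hη', hB i h1, heq⟩
    · exact hgood (B', B, i) (Finset.mem_filter.2 ⟨Finset.mem_univ _, h2⟩)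
        ⟨hη', hB' i h1, heq.symm⟩

omit [FiniteDimensional ℝ F] in
/-- The distance to the convex hull of finitely many points as a convex function; if there are no
points, a positive convex function. -/
lemma exists_convexOn_le_zero_subset_convexHull {X : Set F} (hX : X.Finite) :
    ∃ h : F → ℝ, ConvexOn ℝ Set.univ h ∧ Continuous h ∧ (∀ y, 0 ≤ h y) ∧ (∀ y ∈ X, h y = 0) ∧
      (∀ y, h y = 0 → y ∈ convexHull ℝ X) ∧ ∃ R, ∀ y, ‖y‖ - R ≤ h y := by
  rcases X.eq_empty_or_nonempty with rfl | hne
  · refine ⟨fun y => ‖y‖ + 1, ?_, by fun_prop, fun y => by positivity, by simp, ?_, 0, ?_⟩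
    · exact convexOn_univ_norm.add_const 1
    · intro y hy
      have := norm_nonneg y
      simp only at hy; linarith
    · intro y; simp
  · have hc : IsCompact (convexHull ℝ X) := hX.isCompact_convexHull ℝ
    have hcne : (convexHull ℝ X).Nonempty := hne.convexHull
    refine ⟨fun y => Metric.infDist y (convexHull ℝ X), ⟨convex_univ, ?_⟩,
      Metric.continuous_infDist_pt _, fun y => Metric.infDist_nonneg, ?_, ?_, ?_⟩
    · intro x _ y _ a b ha hb hab
      obtain ⟨x', hx', hxx⟩ := hc.exists_infDist_eq_dist hcne x
      obtain ⟨y', hy', hyy⟩ := hc.exists_infDist_eq_dist hcne y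
      have hmem := (convex_convexHull ℝ X) hx' hy' ha hb hab
      refine (Metric.infDist_le_dist_of_mem hmem).trans ?_
      simp only [hxx, hyy, smul_eq_mul, dist_eq_norm]
      calc ‖a • x + b • y - (a • x' + b • y')‖ = ‖a • (x - x') + b • (y - y')‖ := by
            congr 1; module
        _ ≤ _ := by
            refine (norm_add_le _ _).trans ?_
            rw [norm_smul, norm_smul, Real.norm_of_nonneg ha, Real.norm_of_nonneg hb]
    · intro y hy
      exact Metric.infDist_zero_of_mem (subset_convexHull ℝ X hy)
    · intro y hy
      exact (hc.isClosed.mem_iff_infDist_zero hcne).2 hy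
    · obtain ⟨R, hR⟩ := hc.isBounded.exists_norm_le
      refine ⟨R, fun y => ?_⟩
      obtain ⟨y', hy', hyy⟩ := hc.exists_infDist_eq_dist hcne y
      simp only [hyy, dist_eq_norm]
      have := norm_sub_norm_le y y'
      have := hR y' hy'
      linarith

end Relaxation

end SeqRand

namespace SeqRand

/-! ### An always feasible relaxation of all scenario problems of a multisample. -/

section ScenarioRelaxation

open Filter Topology

/-- A linear functional plus a positive multiple of the squared norm is coercive. -/
lemma tendsto_linear_add_norm_sq_cocompact {F : Type*} [NormedAddCommGroup F] [NormedSpace ℝ F]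
    [FiniteDimensional ℝ F] (ℓ : F →L[ℝ] ℝ) {a : ℝ} (ha : 0 < a) :
    Tendsto (fun z => ℓ z + a * ‖z‖ ^ 2) (cocompact F) atTop := by
  have h1 : Tendsto (fun x : ℝ => x * (a * x - ‖ℓ‖)) atTop atTop :=
    tendsto_id.atTop_mul_atTop₀ (tendsto_atTop_add_const_right _ _ (tendsto_id.const_mul_atTop ha))
  have : ProperSpace F := FiniteDimensional.proper_real F
  refine tendsto_atTop_mono (fun z => ?_) (h1.comp tendsto_norm_cocompact_atTop)
  have h2 := (abs_le.1 (ℓ.le_opNorm z)).1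
  simp only [Function.comp]
  nlinarith

/-- A linear functional plus a positive multiple of the squared norm is strictly convex. -/
lemma strictConvexOn_linear_add_norm_sq {F : Type*} [NormedAddCommGroup F] [InnerProductSpace ℝ F]
    (ℓ : F →L[ℝ] ℝ) {a : ℝ} (ha : 0 < a) :
    StrictConvexOn ℝ Set.univ (fun z => ℓ z + a * ‖z‖ ^ 2) := by
  refine StrongConvexOn.strictConvexOn (m := 2 * a) ?_ (by positivity)
  rw [strongConvexOn_iff_convex]
  have : (fun x : F => ℓ x + a * ‖x‖ ^ 2 - 2 * a / 2 * ‖x‖ ^ 2) = fun x => ℓ x := by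
    funext x; ring
  rw [this]
  exact ℓ.toLinearMap.convexOn convex_univ

namespace UncertainProgram

variable {n : ℕ} {Q : Type*} (P : UncertainProgram n Q)

/-- The objective as a continuous linear functional. -/
noncomputable def costL : EuclideanSpace ℝ (Fin n) →L[ℝ] ℝ := innerSL ℝ P.c

lemma costL_apply (θ : EuclideanSpace ℝ (Fin n)) : P.costL θ = P.cost θ := by
  simp [costL, cost, PiLp.inner_apply, mul_comm]

variable {P} {m : ℕ} {q : Fin m → Q} {S : Finset (Fin m)}

lemma feasibleSet_comp_equivFin (q : Fin m → Q) (S : Finset (Fin m)) :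
    P.feasibleSet (fun i => q (S.equivFin.symm i)) Finset.univ = P.feasibleSet q S := by
  ext θ
  simp only [feasibleSet, Set.mem_ofPred_eq, Finset.mem_univ, true_imp_iff]
  refine and_congr_right fun _ => ⟨fun h i hi => ?_, fun h i => h _ (S.equivFin.symm i).2⟩
  simpa using h (S.equivFin ⟨i, hi⟩)

lemma HasUniqueSolutions.existsUnique (h : P.HasUniqueSolutions) (hS : S.Nonempty)
    (hf : (P.feasibleSet q S).Nonempty) : ∃! θ, P.IsScenarioSolution q S θ := by
  have := h S.card hS.card_pos (fun i => q (S.equivFin.symm i))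
  rw [feasibleSet_comp_equivFin] at this
  simpa only [IsScenarioSolution, feasibleSet_comp_equivFin] using this hf

/-- For small relaxations of the constraints, and a small weight of the cost, no point of the
relaxed program with a violated constraint added beats the solution. -/
lemma eventually_relaxation_lt {h : Fin m → EuclideanSpace ℝ (Fin n) → ℝ}
    (hcont : ∀ i, Continuous (h i)) (hnonneg : ∀ i θ, 0 ≤ h i θ)
    (hcoe : ∀ i, ∃ R, ∀ θ, ‖θ‖ - R ≤ h i θ) (p : EuclideanSpace ℝ (Fin n)) (T : Finset (Fin m))
    (hT : T.Nonempty) (hp : ∀ θ, (∀ i ∈ T, h i θ = 0) → P.cost θ ≤ P.cost p → False) :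
    ∀ᶠ κ in 𝓝[>] (0 : ℝ), ∀ (θ : EuclideanSpace ℝ (Fin n)) (t : ℝ),
      (∀ i ∈ T, h i θ ≤ t + κ ^ 3) →
      κ ^ 2 * P.cost p + κ ^ 3 * ‖p‖ ^ 2 < t + κ ^ 2 * P.cost θ + κ ^ 3 * (‖θ‖ ^ 2 + t ^ 2) := by
  have hcc : Continuous P.cost := by
    have : P.cost = fun θ => P.costL θ := funext fun θ => (P.costL_apply θ).symm
    rw [this]; exact P.costL.continuous
  -- `Ψ` vanishes only at points excluded by `hp`; being continuous and coercive, it has a positive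
  -- minimum, which provides a uniform margin.
  let Ψ : EuclideanSpace ℝ (Fin n) → ℝ := fun θ => ∑ i ∈ T, h i θ + max (P.cost θ - P.cost p) 0
  have hΨc : Continuous Ψ := by
    have := fun i => hcont i
    fun_prop
  obtain ⟨x, hx⟩ := hT
  obtain ⟨R, hR⟩ := hcoe x
  have hΨt : Tendsto Ψ (cocompact _) atTop := by
    refine tendsto_atTop_mono (fun θ => ?_)
      (tendsto_atTop_add_const_right _ (-R) (tendsto_norm_cocompact_atTop
        (E := EuclideanSpace ℝ (Fin n))))
    have h1 := Finset.single_le_sum (f := fun i => h i θ) (fun i _ => hnonneg i θ) hx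
    have h2 := le_max_right (P.cost θ - P.cost p) 0
    have h3 := hR θ
    simp only [Ψ] at *
    linarith
  obtain ⟨θ₀, hθ₀⟩ := hΨc.exists_forall_le hΨt
  have hpos : 0 < Ψ θ₀ := by
    by_contra hle
    have h1 : 0 ≤ ∑ i ∈ T, h i θ₀ := Finset.sum_nonneg fun i _ => hnonneg i θ₀
    have h2 := le_max_right (P.cost θ₀ - P.cost p) 0
    have h3 := le_max_left (P.cost θ₀ - P.cost p) 0
    simp only [Ψ] at hle
    have h4 : ∑ i ∈ T, h i θ₀ = 0 := by linarith
    exact hp θ₀ ((Finset.sum_eq_zero_iff_of_nonneg fun i _ => hnonneg i θ₀).1 h4) (by linarith)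
  -- Exceeding neither the constraints nor the cost by more than `ρ` would give `Ψ ≤ (T.card + 1) *
  -- ρ`, below the minimum.
  set ρ := Ψ θ₀ / (T.card + 2) with hρdef
  have hρ : 0 < ρ := by positivity
  have hρ' : ρ * (T.card + 2) = Ψ θ₀ := by rw [hρdef]; field_simp
  have key : ∀ θ, (∀ i ∈ T, h i θ ≤ ρ) → P.cost θ ≤ P.cost p + ρ → False := by
    intro θ h1 h2
    have h3 := hθ₀ θ
    have h4 : ∑ i ∈ T, h i θ ≤ T.card * ρ := by
      simpa using Finset.sum_le_card_nsmul T _ ρ h1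
    have h5 : max (P.cost θ - P.cost p) 0 ≤ ρ := max_le (by linarith) hρ.le
    have h6 : Ψ θ = ∑ i ∈ T, h i θ + max (P.cost θ - P.cost p) 0 := rfl
    nlinarith
  have hlim1 : ∀ᶠ κ in 𝓝[>] (0 : ℝ),
      κ ^ 2 * P.cost p + κ ^ 3 * ‖p‖ ^ 2 + κ * ‖P.costL‖ ^ 2 + κ ^ 3 < ρ := by
    have : Continuous fun κ : ℝ =>
      κ ^ 2 * P.cost p + κ ^ 3 * ‖p‖ ^ 2 + κ * ‖P.costL‖ ^ 2 + κ ^ 3 := by fun_prop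
    exact (this.continuousAt.eventually_lt continuousAt_const (by simpa using hρ)).filter_mono
      nhdsWithin_le_nhds
  have hlim2 : ∀ᶠ κ in 𝓝[>] (0 : ℝ), κ * (‖p‖ ^ 2 + 1) < ρ := by
    have : Continuous fun κ : ℝ => κ * (‖p‖ ^ 2 + 1) := by fun_prop
    exact (this.continuousAt.eventually_lt continuousAt_const (by simpa using hρ)).filter_mono
      nhdsWithin_le_nhds
  filter_upwards [hlim1, hlim2, self_mem_nhdsWithin] with κ hκ1 hκ2 hκ θ t hθ
  have hκ : 0 < κ := hκ
  by_contra hle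
  rw [not_lt] at hle
  have ht : -κ ^ 3 ≤ t := by linarith [hθ x hx, hnonneg x θ]
  have hcost : -(‖P.costL‖ * ‖θ‖) ≤ P.cost θ := by
    rw [← costL_apply]; exact (abs_le.1 (P.costL.le_opNorm θ)).1
  have hsq : κ ^ 3 * t ^ 2 ≥ 0 := by positivity
  have hθ2 : κ ^ 3 * ‖θ‖ ^ 2 ≥ 0 := by positivity
  refine key θ (fun i hi => (hθ i hi).trans ?_) ?_
  · have h1 : 0 ≤ κ * (κ * ‖θ‖ - ‖P.costL‖) ^ 2 := by positivity
    have h2 : 0 ≤ κ * (κ * ‖θ‖) * ‖P.costL‖ := by positivity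
    have h3 : -(κ ^ 2 * (‖P.costL‖ * ‖θ‖)) ≤ κ ^ 2 * P.cost θ := by
      have := mul_le_mul_of_nonneg_left hcost (sq_nonneg κ)
      linarith
    nlinarith
  · have h1 : κ ^ 2 * P.cost θ ≤ κ ^ 2 * (P.cost p + κ * (‖p‖ ^ 2 + 1)) := by nlinarith
    have h2 := le_of_mul_le_mul_left h1 (by positivity)
    linarith

/-- The scenario problems for a finite multisample have a generic relaxation with at least as many
violated constraints. -/
lemma exists_generic_relaxation (hconvex : P.IsConvex) (hunique : P.HasUniqueSolutions)
    (q : Fin m → Q) : ∃ w : Finset (Fin m) → ℝ, IsGenericLPType (n + 1) w ∧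
      ∀ S : Finset (Fin m), S.Nonempty → ∀ θ, P.IsScenarioSolution q S θ →
        ∀ x, 0 < P.f θ (q x) → w S < w (insert x S) := by
  classical
  have hp : ∀ S : Finset (Fin m), ∃ θ, (S.Nonempty ∧ (P.feasibleSet q S).Nonempty →
      P.IsScenarioSolution q S θ) := fun S => by
    by_cases hS : S.Nonempty ∧ (P.feasibleSet q S).Nonempty
    · obtain ⟨θ, hθ, -⟩ := hunique.existsUnique hS.1 hS.2
      exact ⟨θ, fun _ => hθ⟩
    · exact ⟨0, fun h => absurd h hS⟩
  choose p hp using hp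
  -- Constraint `i` is replaced by the distance to the hull of the finitely many scenario solutions
  -- that respect it. This is continuous and defined everywhere, whereas `f` is controlled only on
  -- `Θ`, and the hull still satisfies the original constraint.
  let X : Fin m → Set (EuclideanSpace ℝ (Fin n)) := fun i =>
    p '' {S | i ∈ S ∧ (P.feasibleSet q S).Nonempty}
  have hXsub : ∀ i, convexHull ℝ (X i) ⊆ {θ | θ ∈ P.Θ ∧ P.f θ (q i) ≤ 0} := by
    intro i
    refine convexHull_min ?_ ((hconvex.2.2 (q i)).convex_le 0)
    rintro _ ⟨S, ⟨hi, hS⟩, rfl⟩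
    have h1 := (hp S ⟨⟨i, hi⟩, hS⟩).1
    exact ⟨h1.1, h1.2 i hi⟩
  choose h hhconv hhcont hhnn hhX hhhull hhcoe using fun i =>
    exists_convexOn_le_zero_subset_convexHull ((Set.toFinite {S : Finset (Fin m) | i ∈ S ∧
      (P.feasibleSet q S).Nonempty}).image p : (X i).Finite)
  have hev : ∀ᶠ κ in 𝓝[>] (0 : ℝ), ∀ (S : Finset (Fin m)) (x : Fin m), S.Nonempty →
      (P.feasibleSet q S).Nonempty → 0 < P.f (p S) (q x) →
      ∀ (θ : EuclideanSpace ℝ (Fin n)) (t : ℝ), (∀ i ∈ insert x S, h i θ ≤ t + κ ^ 3) →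
      κ ^ 2 * P.cost (p S) + κ ^ 3 * ‖p S‖ ^ 2
        < t + κ ^ 2 * P.cost θ + κ ^ 3 * (‖θ‖ ^ 2 + t ^ 2) := by
    rw [eventually_all]; intro S
    rw [eventually_all]; intro x
    by_cases hcond : S.Nonempty ∧ (P.feasibleSet q S).Nonempty ∧ 0 < P.f (p S) (q x)
    · obtain ⟨hS, hf, hx⟩ := hcond
      refine (eventually_relaxation_lt (P := P) hhcont hhnn hhcoe (p S) (insert x S)
        (Finset.insert_nonempty _ _) ?_).mono fun κ hκ _ _ _ => hκ
      -- Such a point would be a second solution for `S`, hence equal to `p S` by uniqueness,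
      -- although `p S` violates `x`.
      intro θ hθ hcost
      have hmem := fun i hi => hXsub i (hhhull i θ (hθ i hi))
      have hfe : θ ∈ P.feasibleSet q S := ⟨(hmem x (Finset.mem_insert_self _ _)).1,
        fun i hi => (hmem i (Finset.mem_insert_of_mem hi)).2⟩
      have hsol := hp S ⟨hS, hf⟩
      have heq : θ = p S := (hunique.existsUnique hS hf).unique
        ⟨hfe, fun θ' hθ' => hcost.trans (hsol.2 θ' hθ')⟩ hsol
      exact absurd (hmem x (Finset.mem_insert_self _ _)).2 (by rw [heq]; exact not_le.2 hx)
    · exact Eventually.of_forall fun κ h1 h2 h3 => absurd ⟨h1, h2, h3⟩ hcond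
  obtain ⟨κ, hκ, hκ0⟩ := (hev.and self_mem_nhdsWithin).exists
  have hκ0 : 0 < κ := hκ0
  -- The extra coordinate is the slack `t`. The weights `1`, `κ ^ 2`, `κ ^ 3` rank slack before cost
  -- before the quadratic term, which supplies strict convexity and coercivity.
  let F := WithLp 2 (EuclideanSpace ℝ (Fin n) × ℝ)
  let fstF : F →L[ℝ] EuclideanSpace ℝ (Fin n) := WithLp.fstL 2 ℝ _ _
  let sndF : F →L[ℝ] ℝ := WithLp.sndL 2 ℝ _ _
  let ℓ : F →L[ℝ] ℝ := sndF + κ ^ 2 • P.costL.comp fstF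
  let G : F → ℝ := fun z => ℓ z + κ ^ 3 * ‖z‖ ^ 2
  have hGval : ∀ z : F, G z = z.snd + κ ^ 2 * P.cost z.fst
      + κ ^ 3 * (‖z.fst‖ ^ 2 + z.snd ^ 2) := by
    intro z
    have : ‖z‖ ^ 2 = ‖z.fst‖ ^ 2 + z.snd ^ 2 := by
      rw [WithLp.prod_norm_sq_eq_of_L2, Real.norm_eq_abs, sq_abs]
    simp only [G, this, ← P.costL_apply]
    rfl
  let φ : Fin m → F → ℝ := fun i z => h i (fstF z) - sndF z
  have hrank : Module.finrank ℝ F = n + 1 := by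
    rw [LinearEquiv.finrank_eq (WithLp.linearEquiv 2 ℝ (EuclideanSpace ℝ (Fin n) × ℝ))]
    simp
  obtain ⟨η, hη, z, hz1, hz2, hz3⟩ := exists_isGenericLPType (G := G) (φ := φ)
    (strictConvexOn_linear_add_norm_sq ℓ (by positivity))
    (ℓ.continuous.add (continuous_const.mul (continuous_norm.pow 2)))
    (tendsto_linear_add_norm_sq_cocompact ℓ (by positivity))
    (fun i => ((hhconv i).comp_linearMap fstF.toLinearMap).sub
      (sndF.toLinearMap.concaveOn convex_univ)) (fun i => ((hhcont i).comp fstF.continuous).sub sndF.continuous)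
    ⟨WithLp.toLp 2 (0, ∑ i, h i 0), fun i => by
      have := Finset.single_le_sum (f := fun i => h i 0) (fun i _ => hhnn i 0) (Finset.mem_univ i)
      exact sub_nonpos.2 this⟩ (r := κ ^ 3) (by positivity)
  rw [hrank] at hz3
  refine ⟨fun S => G (z S), hz3, fun S hS θ hθ x hx => ?_⟩
  have hf : (P.feasibleSet q S).Nonempty := ⟨θ, hθ.1⟩
  obtain rfl : θ = p S := (hunique.existsUnique hS hf).unique hθ (hp S ⟨hS, hf⟩)
  -- The value at `(p S, 0)` separates the two problems: the point is feasible for `S`, while every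
  -- feasible point of `insert x S` costs more.
  have h1 : G (z S) ≤ G (WithLp.toLp 2 (p S, 0)) := by
    refine hz2 S _ fun i hi => ?_
    have : h i (p S) = 0 := hhX i _ ⟨S, ⟨hi, hf⟩, rfl⟩
    have h3 : φ i (WithLp.toLp 2 (p S, 0)) = h i (p S) - 0 := rfl
    rw [h3, this, sub_zero]
    exact (hη i).1.le
  have h2 := hκ S x hS hf hx (z (insert x S)).fst (z (insert x S)).snd (fun i hi => by
    have h3 : h i (z (insert x S)).fst - (z (insert x S)).snd ≤ η i := hz1 (insert x S) i hi
    have h4 := (hη i).2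
    linarith)
  rw [← hGval] at h2
  refine h1.trans_lt (lt_of_eq_of_lt ?_ h2)
  rw [hGval]
  simp

end UncertainProgram

end ScenarioRelaxation

end SeqRand

namespace SeqRand

/-! ### The count for scenario problems with discarded samples. -/

namespace UncertainProgram

variable {n : ℕ} {Q : Type*} {P : UncertainProgram n Q}

lemma feasibleSet_comp_embedding {m N : ℕ} (q : Fin m → Q) (e : Fin N ↪ Fin m)
    (I : Finset (Fin N)) : P.feasibleSet (fun i => q (e i)) I = P.feasibleSet q (I.map e) := by
  ext θ
  simp [feasibleSet]

/-- The number of `N`-element parts of a multisample such that a solution of the problem with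
discarded constraints for this part violates many of the remaining constraints. -/
lemma card_filter_discarded_violations_le (hconvex : P.IsConvex) (hunique : P.HasUniqueSolutions)
    {m : ℕ} (q : Fin m → Q) {N l s j : ℕ} (hN : N = l + s) (hl : n + 1 ≤ l)
    (hj : j + s + n + 1 ≤ m) (bad : Finset (Fin m) → Prop) [DecidablePred bad]
    (hbad : ∀ S, bad S → ∃ (e : Fin N ↪ Fin m) (θ : EuclideanSpace ℝ (Fin n)),
      Finset.univ.map e = S ∧ P.IsDiscardedSolution l (fun i => q (e i)) θ ∧
      ∃ V : Finset (Fin m), j + 1 ≤ V.card ∧ ∀ x ∈ V, x ∉ S ∧ 0 < P.f θ (q x)) :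
    ((Finset.powersetCard N Finset.univ).filter bad).card
      ≤ (s + n).choose s * ∑ i ∈ Finset.range (s + n + 1),
        (j + s + n + 1).choose i * (m - (j + s + n + 1)).choose (N - i) := by
  classical
  obtain ⟨w, hw, hviol⟩ := exists_generic_relaxation hconvex hunique q
  refine le_trans (Finset.card_le_card ?_)
    (hw.isViolatorMap.card_filter_le (N := N) (s := s) (j := j) (by omega) hj)
  intro S hS
  rw [Finset.mem_filter] at hS ⊢
  refine ⟨hS.1, ?_⟩
  obtain ⟨e, θ, hSe, ⟨I, hI, hsol, hopt⟩, V, hVc, hV⟩ := hbad S hS.2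
  have hScard := (Finset.mem_powersetCard.1 hS.1).2
  -- All choices of retained samples that lead to the same solution `θ` compete, since `θ` need not
  -- violate the samples first discarded.
  set 𝒥 := (S.powersetCard l).filter (fun J => P.IsScenarioSolution q J θ) with h𝒥
  have hmem : ∀ J, J ∈ 𝒥 ↔ (J ⊆ S ∧ J.card = l) ∧ P.IsScenarioSolution q J θ := by
    intro J
    rw [h𝒥, Finset.mem_filter, Finset.mem_powersetCard]
  have hne : 𝒥.Nonempty := by
    refine ⟨I.map e, (hmem _).2 ⟨⟨?_, by rw [Finset.card_map, hI]⟩, ?_⟩⟩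
    · rw [← hSe]; exact Finset.map_subset_map.2 (Finset.subset_univ _)
    · simpa only [IsScenarioSolution, feasibleSet_comp_embedding] using hsol
  have hpos : ∀ J ∈ 𝒥, J.Nonempty := fun J hJ =>
    Finset.card_pos.1 (by have := ((hmem J).1 hJ).1.2; omega)
  obtain ⟨J, hJ, D, hDJ, hDc, hvJ, hvS, hvx⟩ := hw.exists_padded_basis_violated (Nat.succ_pos n)
    (S := S) hne (fun J hJ => ((hmem J).1 hJ).1.2.symm ▸ hl) (by
    intro J hJ x hx y hy hwx
    obtain ⟨⟨hJS, hJc⟩, hJsol⟩ := (hmem J).1 hJ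
    rw [Finset.mem_sdiff] at hx
    have hfx : P.f θ (q x) ≤ 0 := by
      by_contra hc
      -- An `x` that leaves the relaxed value unchanged is satisfied by `θ`. Thus `θ` stays feasible
      -- after the exchange, and it stays optimal because it is optimal over all retained sets of
      -- size `l`.
      exact absurd (hviol J (hpos J hJ) θ hJsol x (not_le.1 hc)) (by rw [hwx]; exact lt_irrefl _)
    have hsub : (insert x J).erase y ⊆ S :=
      (Finset.erase_subset _ _).trans (Finset.insert_subset hx.1 hJS)
    have hcard : ((insert x J).erase y).card = l := by
      rw [Finset.card_erase_of_mem (Finset.mem_insert_of_mem hy),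
        Finset.card_insert_of_notMem hx.2, hJc]; rfl
    refine (hmem _).2 ⟨⟨hsub, hcard⟩, ⟨hJsol.1.1, fun i hi => ?_⟩, ?_⟩
    · rcases Finset.mem_insert.1 (Finset.mem_of_mem_erase hi) with rfl | hi
      · exact hfx
      · exact hJsol.1.2 i hi
    · intro θ' hθ'
      rw [← hSe] at hsub
      obtain ⟨I', -, hI'⟩ := Finset.subset_map_iff.1 hsub
      refine hopt I' ?_ θ' ?_
      · rw [← hcard, hI', Finset.card_map]
      · rw [feasibleSet_comp_embedding, ← hI']
        exact hθ')
  obtain ⟨⟨hJS, hJc⟩, hJsol⟩ := (hmem J).1 hJ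
  refine ⟨D, hDJ.trans hJS, hDc, ?_, ?_⟩
  · have : hw.violators D ∩ S = S \ J := by
      ext x
      have h1 := @hvS x
      have h2 : x ∈ hw.violators D → x ∉ J := fun hx => Finset.disjoint_left.1 hvJ hx
      rw [Finset.mem_inter, Finset.mem_sdiff]
      exact ⟨fun h => ⟨h.2, h2 h.1⟩, fun h => ⟨h1 (Finset.mem_sdiff.2 h), h.1⟩⟩
    rw [this, Finset.card_sdiff_of_subset hJS, hScard, hJc]
    omega
  · refine hVc.trans (Finset.card_le_card fun x hx => ?_)
    obtain ⟨hxS, hfx⟩ := hV x hx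
    exact Finset.mem_sdiff.2 ⟨hvx x (hviol J (hpos J hJ) θ hJsol x hfx), hxS⟩

end UncertainProgram

end SeqRand

namespace SeqRand

/-! ### Monotonicity of the binomial bound and the hypergeometric limit. -/

section BinomialTail

open Filter Topology

/-- One more trial leaves the event of at most `e` successes only when there were exactly `e` and
the new trial succeeds. -/
lemma binomial_tail_succ (N e : ℕ) (ε : ℝ) :
    ∑ i ∈ Finset.range (e + 1), ((N + 1).choose i : ℝ) * ε ^ i * (1 - ε) ^ (N + 1 - i)
      = ∑ i ∈ Finset.range (e + 1), (N.choose i : ℝ) * ε ^ i * (1 - ε) ^ (N - i)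
        - (N.choose e : ℝ) * ε ^ (e + 1) * (1 - ε) ^ (N - e) := by
  induction e with
  | zero => simp [pow_succ]; ring
  | succ e ih =>
    rw [Finset.sum_range_succ, ih, Finset.sum_range_succ _ (e + 1), Nat.choose_succ_succ]
    have h1 : N + 1 - (e + 1) = N - e := by omega
    rw [h1]
    rcases Nat.lt_or_ge e N with h | h
    · have h2 : N - e = (N - (e + 1)) + 1 := by omega
      rw [h2, pow_succ]
      push_cast
      ring
    · rw [Nat.succ_eq_add_one, Nat.choose_eq_zero_of_lt (show N < e + 1 by omega)]
      push_cast
      ring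

lemma discardBound_mono {n s r N N' : ℕ} (hsr : s ≤ r) (hN : N ≤ N') {ε : ℝ} (hε₀ : 0 ≤ ε)
    (hε₁ : ε ≤ 1) : discardBound n s N' ε ≤ discardBound n r N ε := by
  have hnn : ∀ N i : ℕ, 0 ≤ (N.choose i : ℝ) * ε ^ i * (1 - ε) ^ (N - i) := fun N i => by
    have := sub_nonneg.2 hε₁
    positivity
  have h1 : discardBound n s N' ε ≤ discardBound n s N ε := by
    refine mul_le_mul_of_nonneg_left ?_ (Nat.cast_nonneg _)
    induction N', hN using Nat.le_induction with
    | base => exact le_rfl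
    | succ N' _ ih =>
      refine le_trans ?_ ih
      rw [binomial_tail_succ]
      have := sub_nonneg.2 hε₁
      have : 0 ≤ (N'.choose (s + n) : ℝ) * ε ^ (s + n + 1) * (1 - ε) ^ (N' - (s + n)) := by
        positivity
      linarith
  refine h1.trans (mul_le_mul ?_ ?_ (Finset.sum_nonneg fun i _ => hnn N i) (Nat.cast_nonneg _))
  · rw [Nat.choose_symm_add, Nat.choose_symm_add]
    exact_mod_cast Nat.choose_le_choose n (by omega)
  · exact Finset.sum_le_sum_of_subset_of_nonneg
      (Finset.range_subset_range.2 (by omega)) fun i _ _ => hnn N i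

/-- The sum is then the full binomial expansion of `1`. Hence the `N` of the algorithm exceeds `r +
n`, and more than `n` samples are retained in the last iteration. -/
lemma one_le_discardBound {n r N : ℕ} (h : N ≤ r + n) {ε : ℝ} (hε₀ : 0 ≤ ε) (hε₁ : ε ≤ 1) :
    1 ≤ discardBound n r N ε := by
  have hnn : ∀ i : ℕ, 0 ≤ (N.choose i : ℝ) * ε ^ i * (1 - ε) ^ (N - i) := fun i => by
    have := sub_nonneg.2 hε₁
    positivity
  have h1 : (1 : ℝ) ≤ ((r + n).choose r : ℝ) := by
    exact_mod_cast Nat.choose_pos (Nat.le_add_right r n)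
  have h2 : (1 : ℝ) ≤ ∑ i ∈ Finset.range (r + n + 1),
      (N.choose i : ℝ) * ε ^ i * (1 - ε) ^ (N - i) := by
    calc (1 : ℝ) = (ε + (1 - ε)) ^ N := by simp
      _ = ∑ i ∈ Finset.range (N + 1), (N.choose i : ℝ) * ε ^ i * (1 - ε) ^ (N - i) := by
        rw [add_pow]; exact Finset.sum_congr rfl fun i _ => by ring
      _ ≤ _ := Finset.sum_le_sum_of_subset_of_nonneg
          (Finset.range_subset_range.2 (by omega)) fun i _ _ => hnn i
  exact one_le_mul_of_one_le_of_one_le h1 h2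

lemma tendsto_choose_div_pow {u m : ℕ → ℕ} {x : ℝ} (hm : Tendsto m atTop atTop)
    (hu : Tendsto (fun k => (u k : ℝ) / m k) atTop (𝓝 x)) (i : ℕ) :
    Tendsto (fun k => ((u k).choose i : ℝ) / (m k : ℝ) ^ i) atTop (𝓝 (x ^ i / (i.factorial : ℝ)))
    := by
  induction i with
  | zero => simp
  | succ i ih =>
    have hm' : Tendsto (fun k => (m k : ℝ)) atTop atTop := tendsto_natCast_atTop_atTop.comp hm
    have h1 : Tendsto (fun k => ((u k - i : ℕ) : ℝ) / m k) atTop (𝓝 x) := by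
      have h2 : Tendsto (fun k => (u k : ℝ) / m k - i / m k) atTop (𝓝 x) := by
        simpa using hu.sub (hm'.const_div_atTop (i : ℝ))
      refine tendsto_of_tendsto_of_tendsto_of_le_of_le h2 hu (fun k => ?_) (fun k => ?_)
      · simp only
        rw [← sub_div]
        apply div_le_div_of_nonneg_right _ (Nat.cast_nonneg _)
        have : u k ≤ (u k - i) + i := by omega
        have : (u k : ℝ) ≤ ((u k - i : ℕ) : ℝ) + i := by exact_mod_cast this
        linarith
      · simp only
        apply div_le_div_of_nonneg_right _ (Nat.cast_nonneg _)
        exact_mod_cast Nat.sub_le _ _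
    have h3 := (ih.mul h1).div_const ((i : ℝ) + 1)
    have h4 : x ^ i / (i.factorial : ℝ) * x / ((i : ℝ) + 1)
        = x ^ (i + 1) / ((i + 1).factorial : ℝ) := by
      rw [Nat.factorial_succ]
      push_cast
      field_simp
      ring
    rw [h4] at h3
    refine h3.congr fun k => ?_
    have h5 : ((u k).choose (i + 1) : ℝ) * ((i : ℝ) + 1) = (u k).choose i * ((u k - i : ℕ) : ℝ) := by
      exact_mod_cast Nat.choose_succ_right_eq (u k) i
    have h6 : ((u k).choose (i + 1) : ℝ) = (u k).choose i * ((u k - i : ℕ) : ℝ) / ((i : ℝ) + 1) := by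
      rw [← h5]; field_simp
    rw [h6, pow_succ, div_mul_div_comm, div_right_comm]

/-- Hypergeometric probabilities converge to binomial probabilities. -/
lemma tendsto_hypergeometric {J m : ℕ → ℕ} {x : ℝ} (hm : Tendsto m atTop atTop)
    (hJm : ∀ k, J k ≤ m k) (hJ : Tendsto (fun k => (J k : ℝ) / m k) atTop (𝓝 x)) {N i : ℕ}
    (hi : i ≤ N) :
    Tendsto (fun k => ((J k).choose i : ℝ) * ((m k - J k).choose (N - i) : ℝ)
      / ((m k).choose N : ℝ)) atTop (𝓝 ((N.choose i : ℝ) * x ^ i * (1 - x) ^ (N - i))) := by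
  have hm' : Tendsto (fun k => (m k : ℝ)) atTop atTop := tendsto_natCast_atTop_atTop.comp hm
  have hne : ∀ᶠ k in atTop, (m k : ℝ) ≠ 0 :=
    (hm'.eventually_gt_atTop 0).mono fun k hk => hk.ne'
  have h1 : Tendsto (fun k => (m k : ℝ) / m k) atTop (𝓝 1) :=
    tendsto_const_nhds.congr' (hne.mono fun k hk => (div_self hk).symm)
  have h2 : Tendsto (fun k => ((m k - J k : ℕ) : ℝ) / m k) atTop (𝓝 (1 - x)) := by
    refine (h1.sub hJ).congr fun k => ?_
    rw [Nat.cast_sub (hJm k), sub_div]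
  have hN : (1 : ℝ) ^ N / (N.factorial : ℝ) ≠ 0 := by positivity
  have h3 := ((tendsto_choose_div_pow hm hJ i).mul (tendsto_choose_div_pow hm h2 (N - i))).div
    (tendsto_choose_div_pow hm h1 N) hN
  have h4 : x ^ i / (i.factorial : ℝ) * ((1 - x) ^ (N - i) / ((N - i).factorial : ℝ))
      / (1 ^ N / (N.factorial : ℝ)) = (N.choose i : ℝ) * x ^ i * (1 - x) ^ (N - i) := by
    rw [Nat.cast_choose ℝ hi, one_pow]
    field_simp
  rw [h4] at h3
  refine h3.congr' (hne.mono fun k hk => ?_)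
  have h5 : (m k : ℝ) ^ N = (m k : ℝ) ^ i * (m k : ℝ) ^ (N - i) := by
    rw [← pow_add, Nat.add_sub_of_le hi]
  simp only [Pi.div_apply, h5]
  rw [div_mul_div_comm, div_div_div_cancel_right₀ (by positivity)]

end BinomialTail

/-! ### Chernoff bounds for fixed and random parameters. -/

section Chernoff

variable {Q : Type*} [MeasurableSpace Q] (μ : Measure Q) [IsProbabilityMeasure μ]

lemma exp_neg_le_quadratic {ρ : ℝ} (hρ : 0 ≤ ρ) : Real.exp (-ρ) ≤ 1 - ρ + ρ ^ 2 / 2 := by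
  have h1 := Real.quadratic_le_exp_of_nonneg hρ
  rw [Real.exp_neg, inv_le_iff_one_le_mul₀ (Real.exp_pos _)]
  have h2 : 0 < 1 - ρ + ρ ^ 2 / 2 := by nlinarith [sq_nonneg (ρ - 1)]
  nlinarith [mul_le_mul_of_nonneg_left h1 h2.le, sq_nonneg (ρ ^ 2)]

/-- Multiplicative Chernoff bound for the lower tail of an empirical frequency. -/
lemma measureReal_freq_le {U : Set Q} (hU : MeasurableSet U) {ε ρ : ℝ} (hε : 0 ≤ ε)
    (hεU : ε ≤ μ.real U) (hρ : 0 ≤ ρ) (M : ℕ) :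
    (Measure.pi fun _ : Fin M => μ).real
      {q | 1 / (M : ℝ) * ∑ i, U.indicator (fun _ => (1 : ℝ)) (q i) ≤ (1 - ρ) * ε}
      ≤ Real.exp (-(M * ε * ρ ^ 2 / 2)) := by
  rcases Nat.eq_zero_or_pos M with rfl | hM
  · simp
  have hM' : (0 : ℝ) < M := by exact_mod_cast hM
  set X : (Fin M → Q) → ℝ := fun q => ∑ i, U.indicator (fun _ => (1 : ℝ)) (q i) with hX
  have hind : Measurable (U.indicator (fun _ => (1 : ℝ))) := measurable_const.indicator hU
  have hXm : Measurable X :=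
    Finset.measurable_sum _ fun i _ => hind.comp (measurable_pi_apply i)
  have hX0 : ∀ q, 0 ≤ X q := fun q =>
    Finset.sum_nonneg fun i _ => Set.indicator_nonneg (fun _ _ => zero_le_one) _
  have hset : {q | 1 / (M : ℝ) * ∑ i, U.indicator (fun _ => (1 : ℝ)) (q i) ≤ (1 - ρ) * ε}
      = {q | X q ≤ M * ((1 - ρ) * ε)} := by
    ext q
    simp only [Set.mem_ofPred_eq, hX]
    rw [one_div_mul_eq_div, div_le_iff₀' hM']
  have hint : Integrable (fun q => Real.exp (-ρ * X q)) (Measure.pi fun _ : Fin M => μ) := by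
    refine Integrable.of_bound (C := 1) (by fun_prop) (Filter.Eventually.of_forall fun q => ?_)
    rw [Real.norm_of_nonneg (Real.exp_pos _).le, Real.exp_le_one_iff]
    nlinarith [hX0 q]
  rw [hset]
  -- The parameter `-ρ` suffices: per sample the exponent is `ε * (ρ * (1 - ρ) - ρ + ρ ^ 2 / 2) = -ε
  -- * ρ ^ 2 / 2`.
  refine (measure_le_le_exp_mul_mgf _ (neg_nonpos.2 hρ) hint).trans ?_
  have hone : ∫ x, Real.exp (-ρ * U.indicator (fun _ => (1 : ℝ)) x) ∂μ
      ≤ Real.exp (ε * (-ρ + ρ ^ 2 / 2)) := by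
    have h1 : ∀ x, Real.exp (-ρ * U.indicator (fun _ => (1 : ℝ)) x)
        = 1 + U.indicator (fun _ => Real.exp (-ρ) - 1) x := by
      intro x
      by_cases hx : x ∈ U <;> simp [hx]
    simp_rw [h1]
    rw [integral_add (integrable_const _) ((integrable_const _).indicator hU),
      integral_indicator_const _ hU]
    simp only [integral_const, probReal_univ, smul_eq_mul, mul_one]
    have h2 := exp_neg_le_quadratic hρ
    have h3 : Real.exp (-ρ) ≤ 1 := Real.exp_le_one_iff.2 (neg_nonpos.2 hρ)
    have h4 := Real.add_one_le_exp (ε * (-ρ + ρ ^ 2 / 2))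
    nlinarith
  have hmgf : mgf X (Measure.pi fun _ : Fin M => μ) (-ρ)
      = (∫ x, Real.exp (-ρ * U.indicator (fun _ => (1 : ℝ)) x) ∂μ) ^ M := by
    have := integral_fintype_prod_eq_pow (ι := Fin M) (μ := μ)
      (fun x => Real.exp (-ρ * U.indicator (fun _ => (1 : ℝ)) x))
    rw [Fintype.card_fin] at this
    rw [← this, mgf]
    congr 1
    funext q
    simp only [hX]
    rw [Finset.mul_sum, Real.exp_sum]
  rw [hmgf]
  have h5 : (∫ x, Real.exp (-ρ * U.indicator (fun _ => (1 : ℝ)) x) ∂μ) ^ M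
      ≤ Real.exp (ε * (-ρ + ρ ^ 2 / 2)) ^ M :=
    pow_le_pow_left₀ (integral_nonneg fun x => (Real.exp_pos _).le) hone M
  refine (mul_le_mul_of_nonneg_left h5 (Real.exp_pos _).le).trans (le_of_eq ?_)
  rw [← Real.exp_nat_mul, ← Real.exp_add]
  congr 1
  ring

/-- The relative frequency of `(θ, q i) ∈ A`. -/
noncomputable def freq {E : Type*} (A : Set (E × Q)) {M : ℕ} (θ : E) (q : Fin M → Q) : ℝ :=
  1 / (M : ℝ) * ∑ i, A.indicator (fun _ => (1 : ℝ)) (θ, q i)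

lemma measurable_freq {E : Type*} [MeasurableSpace E] {A : Set (E × Q)} (hA : MeasurableSet A)
    (M : ℕ) : Measurable fun p : E × (Fin M → Q) => freq A p.1 p.2 := by
  refine Measurable.const_mul (Finset.measurable_sum _ fun i _ => ?_) _
  exact (measurable_const.indicator hA).comp (by fun_prop)

omit [IsProbabilityMeasure μ] in
lemma measurable_measureReal_section [SFinite μ] {E : Type*} [MeasurableSpace E] {A : Set (E × Q)}
    (hA : MeasurableSet A) : Measurable fun θ : E => μ.real (Prod.mk θ ⁻¹' A) :=
  (measurable_measure_prodMk_left hA).ennreal_toReal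

omit [IsProbabilityMeasure μ] in
lemma measurableSet_lt_section_and_freq_le [SFinite μ] {E : Type*} [MeasurableSpace E]
    {A : Set (E × Q)} (hA : MeasurableSet A) (ε a : ℝ) (M : ℕ) :
    MeasurableSet {p : E × (Fin M → Q) | ε < μ.real (Prod.mk p.1 ⁻¹' A) ∧ freq A p.1 p.2 ≤ a} :=
  (measurableSet_lt measurable_const
    ((measurable_measureReal_section μ hA).comp measurable_fst)).inter
    (measurableSet_le (measurable_freq hA M) measurable_const)

omit [IsProbabilityMeasure μ] in
lemma nullMeasurableSet_lt_section_and_freq_le [SFinite μ] {E X : Type*} [MeasurableSpace E]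
    [MeasurableSpace X] {ν : Measure X} {A : Set (E × Q)} (hA : MeasurableSet A)
    {g : X → E} (hg : AEMeasurable g ν) (ε a : ℝ) (M : ℕ) :
    NullMeasurableSet {p : X × (Fin M → Q) |
      ε < μ.real (Prod.mk (g p.1) ⁻¹' A) ∧ freq A (g p.1) p.2 ≤ a}
      (ν.prod (Measure.pi fun _ : Fin M => μ)) :=
  (hg.comp_fst.prodMk measurable_snd.aemeasurable).nullMeasurableSet_preimage
    (measurableSet_lt_section_and_freq_le μ hA ε a M)

/-- Chernoff bound for the validation of a random parameter. -/
lemma measureReal_freq_le_of_lt {E X : Type*} [MeasurableSpace E] [MeasurableSpace X]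
    (ν : Measure X) [IsProbabilityMeasure ν] {A : Set (E × Q)} (hA : MeasurableSet A)
    {g : X → E} (hg : AEMeasurable g ν) {ε ρ : ℝ} (hε : 0 ≤ ε) (hρ : 0 ≤ ρ) (M : ℕ) :
    (ν.prod (Measure.pi fun _ : Fin M => μ)).real
      {p | ε < μ.real (Prod.mk (g p.1) ⁻¹' A) ∧ freq A (g p.1) p.2 ≤ (1 - ρ) * ε}
      ≤ Real.exp (-(M * ε * ρ ^ 2 / 2)) := by
  set π := Measure.pi fun _ : Fin M => μ
  set T : Set (E × (Fin M → Q)) :=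
    {p | ε < μ.real (Prod.mk p.1 ⁻¹' A) ∧ freq A p.1 p.2 ≤ (1 - ρ) * ε} with hT
  have hTm : MeasurableSet T := measurableSet_lt_section_and_freq_le μ hA ε _ M
  have hae : (ν.prod π).real {p | ε < μ.real (Prod.mk (g p.1) ⁻¹' A) ∧
      freq A (g p.1) p.2 ≤ (1 - ρ) * ε}
      = (ν.prod π).real ((fun p : X × (Fin M → Q) => (hg.mk g p.1, p.2)) ⁻¹' T) := by
    apply measureReal_congr
    have h1 : ∀ᵐ p ∂(ν.prod π), g p.1 = hg.mk g p.1 :=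
      Measure.quasiMeasurePreserving_fst.ae hg.ae_eq_mk
    filter_upwards [h1] with p hp
    apply propext
    change (_ ∧ _) ↔ (_ ∧ _)
    rw [hp]
  rw [hae, measureReal_def, Measure.prod_apply
    ((by have := hg.measurable_mk; fun_prop :
      Measurable fun p : X × (Fin M → Q) => (hg.mk g p.1, p.2)) hTm)]
  refine ENNReal.toReal_le_of_le_ofReal (Real.exp_pos _).le ?_
  calc _ ≤ ∫⁻ _, ENNReal.ofReal (Real.exp (-(M * ε * ρ ^ 2 / 2))) ∂ν := by
        refine lintegral_mono fun x => ?_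
        by_cases hx : ε < μ.real (Prod.mk (hg.mk g x) ⁻¹' A)
        · have := measureReal_freq_le μ (measurable_prodMk_left hA :
            MeasurableSet (Prod.mk (hg.mk g x) ⁻¹' A)) hε hx.le hρ M
          refine le_trans (measure_mono ?_) ((ENNReal.le_ofReal_iff_toReal_le (measure_ne_top _ _)
            (Real.exp_pos _).le).2 this)
          rintro q ⟨-, hq⟩
          exact hq
        · refine le_trans (le_of_eq ?_) zero_le
          convert measure_empty (μ := π)
          ext q
          simp [hT, hx]
    _ = _ := by simp

end Chernoff

end SeqRand

namespace SeqRand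

/-! ### Symmetrisation with ghost samples and the violation bound. -/

section Sampling

open Filter Topology

variable {Q : Type*} [MeasurableSpace Q] {μ : Measure Q} [IsProbabilityMeasure μ]

/-- Two disjoint subfamilies of an i.i.d. family are jointly distributed as a product. -/
lemma measurePreserving_pair_of_iIndepFun {Ω ι : Type*} [MeasurableSpace Ω] {Pr : Measure Ω}
    [IsProbabilityMeasure Pr] {X : ι → Ω → Q} (hX : ∀ i, Measurable (X i) ∧ Pr.map (X i) = μ)
    (hind : iIndepFun X Pr) {N k : ℕ} {g : Fin N ⊕ Fin k → ι} (hg : Function.Injective g) :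
    MeasurePreserving (fun ω => ((fun i => X (g (.inl i)) ω, fun j => X (g (.inr j)) ω) :
      (Fin N → Q) × (Fin k → Q))) Pr
      ((Measure.pi fun _ => μ).prod (Measure.pi fun _ => μ)) := by
  have h1 := (iIndepFun_iff_map_fun_eq_pi_map
    (fun i => (hX (g i)).1.aemeasurable)).1 (hind.precomp hg)
  simp_rw [fun i => (hX (g i)).2] at h1
  have h2 : MeasurePreserving (fun ω i => X (g i) ω) Pr
      (Measure.pi fun _ : Fin N ⊕ Fin k => μ) :=
    ⟨measurable_pi_lambda _ fun i => (hX (g i)).1, h1⟩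
  exact (measurePreserving_sumPiEquivProdPi (fun _ : Fin N ⊕ Fin k => μ)).comp h2

/-- If every multisample has at most `c` parts of size `N` for which an event occurs, then the event
has probability at most `c / (N + k).choose N`. -/
lemma choose_mul_measureReal_le {N k c : ℕ} {B : Set ((Fin N → Q) × (Fin k → Q))}
    (hB : NullMeasurableSet B ((Measure.pi fun _ => μ).prod (Measure.pi fun _ => μ)))
    (hc : ∀ (q : Fin (N + k) → Q) (bad : Finset (Fin (N + k)) → Prop) [DecidablePred bad],
      (∀ S, bad S → ∃ e : Fin N ⊕ Fin k ≃ Fin (N + k),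
        Finset.univ.map (Function.Embedding.inl.trans e.toEmbedding) = S ∧
        ((fun i => q (e (.inl i)), fun j => q (e (.inr j))) : (Fin N → Q) × (Fin k → Q)) ∈ B) →
      ((Finset.powersetCard N Finset.univ).filter bad).card ≤ c) :
    ((N + k).choose N : ℝ) *
      ((Measure.pi fun _ => μ).prod (Measure.pi fun _ => μ)).real B ≤ c := by
  classical
  have hE : ∀ S : Finset (Fin (N + k)), ∃ e : Fin N ⊕ Fin k ≃ Fin (N + k), S.card = N →
      Finset.univ.map (Function.Embedding.inl.trans e.toEmbedding) = S := by
    intro S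
    by_cases hS : S.card = N
    · have hS' : Sᶜ.card = k := by rw [Finset.card_compl, Fintype.card_fin, hS]; omega
      refine ⟨finSumEquivOfFinset hS hS', fun _ => ?_⟩
      refine Finset.eq_of_subset_of_card_le (fun x hx => ?_) (by simp [hS])
      obtain ⟨i, -, rfl⟩ := Finset.mem_map.1 hx
      simp
    · exact ⟨finSumFinEquiv, fun h => absurd h hS⟩
  choose e he using hE
  set π := (Measure.pi fun _ : Fin N => μ).prod (Measure.pi fun _ : Fin k => μ) with hπ
  set ν := Measure.pi fun _ : Fin (N + k) => μ with hν
  -- Every way of splitting `N + k` samples has the same law, so the probability is the expected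
  -- fraction of splittings for which the event occurs.
  let Y : Finset (Fin (N + k)) → (Fin (N + k) → Q) → (Fin N → Q) × (Fin k → Q) := fun S q =>
    (fun i => q (e S (.inl i)), fun j => q (e S (.inr j)))
  have hY : ∀ S, MeasurePreserving (Y S) ν π := fun S =>
    measurePreserving_pair_of_iIndepFun (X := fun i (q : Fin (N + k) → Q) => q i)
      (fun i => ⟨measurable_pi_apply i, (measurePreserving_eval (fun _ => μ) i).map_eq⟩)
      (iIndepFun_pi (μ := fun _ : Fin (N + k) => μ) (X := fun _ x => x)
        (fun _ => aemeasurable_id)) (e S).injective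
  have h1 : ∀ S, ∫ q, (Y S ⁻¹' B).indicator (fun _ => (1 : ℝ)) q ∂ν = π.real B := fun S => by
    have hn : NullMeasurableSet (Y S ⁻¹' B) ν := hB.preimage (hY S).quasiMeasurePreserving
    rw [integral_indicator₀ hn, setIntegral_const, smul_eq_mul, mul_one, measureReal_def,
      measureReal_def, (hY S).measure_preimage hB]
  have h2 : ((N + k).choose N : ℝ) * π.real B
      = ∫ q, ∑ S ∈ Finset.powersetCard N Finset.univ,
          (Y S ⁻¹' B).indicator (fun _ => (1 : ℝ)) q ∂ν := by
    rw [integral_finsetSum]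
    · simp_rw [h1]
      rw [Finset.sum_const, Finset.card_powersetCard, Finset.card_univ, Fintype.card_fin,
        nsmul_eq_mul]
    · intro S _
      exact (integrable_const (1 : ℝ)).indicator₀
        (hB.preimage (hY S).quasiMeasurePreserving)
  rw [h2]
  have h3 : ∀ q, ∑ S ∈ Finset.powersetCard N Finset.univ,
      (Y S ⁻¹' B).indicator (fun _ => (1 : ℝ)) q ≤ c := by
    intro q
    have h4 : ∑ S ∈ Finset.powersetCard N Finset.univ,
        (Y S ⁻¹' B).indicator (fun _ => (1 : ℝ)) q
        = ((Finset.powersetCard N Finset.univ).filter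
            (fun S => S.card = N ∧ Y S q ∈ B)).card := by
      rw [Finset.card_filter]
      push_cast
      refine Finset.sum_congr rfl fun S hS => ?_
      have := (Finset.mem_powersetCard.1 hS).2
      by_cases h : Y S q ∈ B <;> simp [h, this]
    rw [h4]
    exact_mod_cast hc q (fun S => S.card = N ∧ Y S q ∈ B) fun S hS => ⟨e S, he S hS.1, hS.2⟩
  calc _ ≤ ∫ _, (c : ℝ) ∂ν := integral_mono_of_nonneg
        (Eventually.of_forall fun q => Finset.sum_nonneg fun S _ =>
          Set.indicator_nonneg (fun _ _ => zero_le_one) _) (integrable_const _)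
        (Eventually.of_forall h3)
    _ = c := by simp

namespace UncertainProgram

variable {n : ℕ} {P : UncertainProgram n Q}

/-- The pairs of an admissible decision and an uncertainty for which the constraint fails. -/
def violationSet (P : UncertainProgram n Q) : Set (EuclideanSpace ℝ (Fin n) × Q) :=
  {p | p.1 ∈ P.Θ ∧ 0 < P.f p.1 p.2}

omit [MeasurableSpace Q] in
lemma mem_violationSet {θ : EuclideanSpace ℝ (Fin n)} (hθ : θ ∈ P.Θ) {x : Q} :
    (θ, x) ∈ P.violationSet ↔ 0 < P.f θ x := by
  simp [violationSet, hθ]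

/-- Measurability of `f` is given only on `Θ × Q`, so the set is built as an image under a
measurable embedding. -/
lemma measurableSet_violationSet (hmeas : Measurable (fun p : P.Θ × Q => P.f p.1 p.2))
    (hΘ : MeasurableSet P.Θ) : MeasurableSet P.violationSet := by
  have h1 : P.violationSet = (Prod.map (Subtype.val : P.Θ → _) (id : Q → Q)) ''
      {p : P.Θ × Q | 0 < P.f p.1 p.2} := by
    ext ⟨θ, x⟩
    constructor
    · rintro ⟨h, h'⟩
      exact ⟨(⟨θ, h⟩, x), h', rfl⟩
    · rintro ⟨⟨⟨θ', h⟩, x'⟩, h', heq⟩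
      obtain ⟨rfl, rfl⟩ := Prod.mk.inj heq
      exact ⟨h, h'⟩
  rw [h1]
  exact (MeasurableEmbedding.prodMap (.subtype_coe hΘ) .id).measurableSet_image.2
    (measurableSet_lt measurable_const hmeas)

lemma measureReal_violationSet_section (μ : Measure Q) {θ : EuclideanSpace ℝ (Fin n)}
    (hθ : θ ∈ P.Θ) : μ.real (Prod.mk θ ⁻¹' P.violationSet) = P.violation μ θ := by
  unfold violation
  congr 1
  ext x
  exact mem_violationSet hθ

omit [MeasurableSpace Q] in
lemma freq_violationSet {θ : EuclideanSpace ℝ (Fin n)} (hθ : θ ∈ P.Θ) {M : ℕ} (q : Fin M → Q) :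
    freq P.violationSet θ q = P.empViolation θ q := by
  unfold freq empViolation
  congr 1
  refine Finset.sum_congr rfl fun i _ => ?_
  by_cases h : 0 < P.f θ (q i)
  · rw [Set.indicator_of_mem ((mem_violationSet hθ).2 h), if_neg (not_le.2 h)]
  · rw [Set.indicator_of_notMem (fun hc => h ((mem_violationSet hθ).1 hc)), if_pos (not_lt.1 h)]

omit [MeasurableSpace Q] in
lemma IsDiscardedSolution.mem {N l : ℕ} {q : Fin N → Q} {θ : EuclideanSpace ℝ (Fin n)}
    (h : P.IsDiscardedSolution l q θ) : θ ∈ P.Θ := by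
  obtain ⟨I, -, h, -⟩ := h
  exact h.1.1

omit [IsProbabilityMeasure μ] in
/-- Feasibility of the design problem is an event, because it can be read off the solution. -/
lemma nullMeasurableSet_discardedFeasible
    (hmeas : Measurable (fun p : P.Θ × Q => P.f p.1 p.2)) (hΘ : MeasurableSet P.Θ) {N l : ℕ}
    {g : (Fin N → Q) → EuclideanSpace ℝ (Fin n)}
    (hg : AEMeasurable g (Measure.pi fun _ => μ))
    (hsol : ∀ q, P.DiscardedFeasible l q → P.IsDiscardedSolution l q (g q)) :
    NullMeasurableSet {q | P.DiscardedFeasible l q} (Measure.pi fun _ : Fin N => μ) := by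
  classical
  set T : Set (EuclideanSpace ℝ (Fin n) × (Fin N → Q)) :=
    {p | p.1 ∈ P.Θ ∧ ∃ J ∈ Finset.powersetCard l (Finset.univ : Finset (Fin N)),
      ∀ i ∈ J, (p.1, p.2 i) ∉ P.violationSet} with hT
  have hTm : MeasurableSet T := by
    have hA := measurableSet_violationSet hmeas hΘ
    refine (hΘ.preimage measurable_fst).inter ?_
    have : {p : EuclideanSpace ℝ (Fin n) × (Fin N → Q) |
        ∃ J ∈ Finset.powersetCard l (Finset.univ : Finset (Fin N)),
        ∀ i ∈ J, (p.1, p.2 i) ∉ P.violationSet}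
        = ⋃ J ∈ Finset.powersetCard l (Finset.univ : Finset (Fin N)), ⋂ i ∈ J,
          (fun p : EuclideanSpace ℝ (Fin n) × (Fin N → Q) => (p.1, p.2 i)) ⁻¹' P.violationSetᶜ := by
      ext p; simp
    have h2 := Finset.measurableSet_biUnion (Finset.powersetCard l (Finset.univ : Finset (Fin N)))
      fun J _ => Finset.measurableSet_biInter J fun i _ => hA.compl.preimage
        (by fun_prop : Measurable
          fun p : EuclideanSpace ℝ (Fin n) × (Fin N → Q) => (p.1, p.2 i))
    rw [← this] at h2
    exact h2
  have heq : {q | P.DiscardedFeasible l q} = (fun q => (g q, q)) ⁻¹' T := by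
    ext q
    constructor
    · intro h
      obtain ⟨I, hI, hs, -⟩ := hsol q h
      refine ⟨hs.1.1, I, Finset.mem_powersetCard.2 ⟨Finset.subset_univ _, hI⟩, fun i hi hv => ?_⟩
      exact absurd ((mem_violationSet hs.1.1).1 hv) (not_lt.2 (hs.1.2 i hi))
    · rintro ⟨hθ, J, hJ, h⟩
      exact ⟨J, (Finset.mem_powersetCard.1 hJ).2, g q, hθ, fun i hi =>
        not_lt.1 fun hc => h i hi ((mem_violationSet hθ).2 hc)⟩
  rw [heq]
  exact (hg.prodMk aemeasurable_id).nullMeasurableSet_preimage hTm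

variable {N l s : ℕ} {g : (Fin N → Q) → EuclideanSpace ℝ (Fin n)}

/-- The probability that many of `k` new samples are violated by the solution of the design problem
is bounded by a hypergeometric tail. -/
lemma measureReal_lt_freq_le (hmeas : Measurable (fun p : P.Θ × Q => P.f p.1 p.2))
    (hconvex : P.IsConvex) (hunique : P.HasUniqueSolutions) (hN : N = l + s) (hl : n + 1 ≤ l)
    (hg : AEMeasurable g (Measure.pi fun _ => μ))
    (hsol : ∀ q, P.DiscardedFeasible l q → P.IsDiscardedSolution l q (g q)) {a : ℝ} (ha₀ : 0 ≤ a)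
    (ha₁ : a ≤ 1) (k : ℕ) :
    ((Measure.pi fun _ : Fin N => μ).prod (Measure.pi fun _ : Fin k => μ)).real
      {p | P.DiscardedFeasible l p.1 ∧ a < freq P.violationSet (g p.1) p.2}
      ≤ ((s + n).choose s : ℝ) * ∑ i ∈ Finset.range (s + n + 1),
        ((⌊a * k⌋₊ + s + n + 1).choose i : ℝ) *
          ((N + k - (⌊a * k⌋₊ + s + n + 1)).choose (N - i) : ℝ) / ((N + k).choose N : ℝ) := by
  classical
  have hΘ := hconvex.2.1.measurableSet
  have hA := measurableSet_violationSet hmeas hΘ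
  have hB : NullMeasurableSet {p : (Fin N → Q) × (Fin k → Q) |
      P.DiscardedFeasible l p.1 ∧ a < freq P.violationSet (g p.1) p.2}
      ((Measure.pi fun _ => μ).prod (Measure.pi fun _ => μ)) := by
    refine ((nullMeasurableSet_discardedFeasible hmeas hΘ hg hsol).preimage
      Measure.quasiMeasurePreserving_fst).inter ?_
    exact ((hg.comp_fst.prodMk measurable_snd.aemeasurable).nullMeasurableSet_preimage
      (measurableSet_lt measurable_const (measurable_freq hA k)) : _)
  have hfl : ⌊a * k⌋₊ ≤ k := by
    refine Nat.floor_le_of_le ?_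
    nlinarith [(Nat.cast_nonneg k : (0 : ℝ) ≤ k)]
  have hpos : (0 : ℝ) < (N + k).choose N := by
    exact_mod_cast Nat.choose_pos (Nat.le_add_right N k)
  rw [← Finset.sum_div, mul_div_assoc', le_div_iff₀' hpos]
  have key := choose_mul_measureReal_le hB
    (c := (s + n).choose s * ∑ i ∈ Finset.range (s + n + 1),
        (⌊a * k⌋₊ + s + n + 1).choose i *
          (N + k - (⌊a * k⌋₊ + s + n + 1)).choose (N - i)) ?_
  · exact_mod_cast key
  intro q bad _ hbad
  refine card_filter_discarded_violations_le hconvex hunique q hN hl (by omega) bad fun S hS => ?_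
  obtain ⟨e, he, hf, hlt⟩ := hbad S hS
  set q₁ : Fin N → Q := fun i => q (e (.inl i)) with hq₁
  have hθ := (hsol q₁ hf).mem
  refine ⟨Function.Embedding.inl.trans e.toEmbedding, g q₁, he, hsol q₁ hf,
    (Finset.univ.filter (fun j : Fin k => 0 < P.f (g q₁) (q (e (.inr j))))).map
      (Function.Embedding.inr.trans e.toEmbedding), ?_, ?_⟩
  · rw [Finset.card_map]
    have hk : (0 : ℝ) < k := by
      rcases Nat.eq_zero_or_pos k with rfl | hk
      · simp [freq] at hlt; linarith
      · exact_mod_cast hk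
    have h1 : freq P.violationSet (g q₁) (fun j => q (e (.inr j))) = 1 / (k : ℝ) *
        ((Finset.univ.filter (fun j : Fin k => 0 < P.f (g q₁) (q (e (.inr j))))).card : ℝ) := by
      rw [freq, Finset.card_filter]
      push_cast
      congr 1
      refine Finset.sum_congr rfl fun j _ => ?_
      rw [Set.indicator_apply]
      simp only [mem_violationSet hθ]
    simp only at hlt
    rw [h1, one_div_mul_eq_div, lt_div_iff₀ hk] at hlt
    -- A frequency above `a` means at least `⌊a * k⌋₊ + 1` violated ghost samples, so `j = ⌊a * k⌋₊`
    -- in the count.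
    exact (Nat.floor_lt (by positivity)).2 hlt
  · intro x hx
    obtain ⟨j, hj, rfl⟩ := Finset.mem_map.1 hx
    refine ⟨?_, (Finset.mem_filter.1 hj).2⟩
    rw [← he]
    simp

/-- The solution of a scenario problem with discarded constraints has small violation
probability. -/
lemma measureReal_lt_violation_le_discardBound
    (hmeas : Measurable (fun p : P.Θ × Q => P.f p.1 p.2))
    (hconvex : P.IsConvex) (hunique : P.HasUniqueSolutions) (hN : N = l + s) (hl : n + 1 ≤ l)
    (hg : AEMeasurable g (Measure.pi fun _ => μ))
    (hsol : ∀ q, P.DiscardedFeasible l q → P.IsDiscardedSolution l q (g q)) {ε : ℝ} (hε₀ : 0 < ε)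
    (hε₁ : ε < 1) :
    (Measure.pi fun _ : Fin N => μ).real
      {q | P.DiscardedFeasible l q ∧ ε < P.violation μ (g q)} ≤ discardBound n s N ε := by
  have hA := measurableSet_violationSet hmeas hconvex.2.1.measurableSet
  set p₀ := (Measure.pi fun _ : Fin N => μ).real
      {q | P.DiscardedFeasible l q ∧ ε < P.violation μ (g q)} with hp₀
  -- the bound for the frequency threshold `(1 - ρ) ε`
  have hρ : ∀ ρ ∈ Set.Ioo (0 : ℝ) 1, p₀ ≤ discardBound n s N ((1 - ρ) * ε) := by
    rintro ρ ⟨hρ₀, hρ₁⟩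
    set a := (1 - ρ) * ε with ha
    have ha₀ : 0 ≤ a := mul_nonneg (by linarith) hε₀.le
    have ha₁ : a ≤ 1 := by nlinarith
    have hk : ∀ k : ℕ, p₀ ≤ Real.exp (-(k * ε * ρ ^ 2 / 2)) +
        ((s + n).choose s : ℝ) * ∑ i ∈ Finset.range (s + n + 1),
        ((⌊a * k⌋₊ + s + n + 1).choose i : ℝ) *
          ((N + k - (⌊a * k⌋₊ + s + n + 1)).choose (N - i) : ℝ) / ((N + k).choose N : ℝ) := by
      intro k
      set π := (Measure.pi fun _ : Fin N => μ).prod (Measure.pi fun _ : Fin k => μ)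
      have h1 : p₀ = π.real ({q | P.DiscardedFeasible l q ∧ ε < P.violation μ (g q)} ×ˢ
          (Set.univ : Set (Fin k → Q))) := by
        rw [measureReal_prod_prod]; simp [hp₀]
      have h2 := measureReal_freq_le_of_lt μ (Measure.pi fun _ : Fin N => μ) hA hg hε₀.le hρ₀.le k
      have h3 := measureReal_lt_freq_le hmeas hconvex hunique hN hl hg hsol ha₀ ha₁ k
      refine le_trans ?_ (add_le_add h2 h3)
      rw [h1]
      refine le_trans (measureReal_mono ?_) (measureReal_union_le _ _)
      rintro ⟨q, q'⟩ ⟨⟨hf, hv⟩, -⟩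
      have hθ := (hsol q hf).mem
      -- A bad solution either looks good on the ghost samples, which is rare by Chernoff, or
      -- visibly violates many of them, which the count makes rare.
      rcases le_or_gt (freq P.violationSet (g q) q') a with h | h
      · exact Or.inl ⟨by rw [measureReal_violationSet_section μ hθ]; exact hv, h⟩
      · exact Or.inr ⟨hf, h⟩
    have hfl : ∀ k : ℕ, ⌊a * k⌋₊ ≤ k := fun k => by
      refine Nat.floor_le_of_le ?_
      nlinarith [(Nat.cast_nonneg k : (0 : ℝ) ≤ k)]
    have hm : Tendsto (fun k => N + k) atTop atTop := 
      tendsto_atTop_mono (fun k => Nat.le_add_left k N) tendsto_id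
    have hJ : Tendsto (fun k : ℕ => ((⌊a * k⌋₊ + s + n + 1 : ℕ) : ℝ) / ((N + k : ℕ) : ℝ)) atTop
        (𝓝 a) := by
      have hcast : Tendsto (fun k : ℕ => (k : ℝ)) atTop atTop := tendsto_natCast_atTop_atTop
      have h1 := (tendsto_nat_floor_mul_div_atTop ha₀).comp hcast
      have h2 := hcast.const_div_atTop ((s : ℝ) + n + 1)
      have h3 := hcast.const_div_atTop (N : ℝ)
      have h4 := (h1.add h2).div (h3.add_const 1) (by norm_num)
      simp only [add_zero, zero_add, div_one] at h4
      refine h4.congr' ((eventually_gt_atTop 0).mono fun k hk => ?_)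
      have : (0 : ℝ) < k := by exact_mod_cast hk
      simp only [Pi.div_apply, Function.comp]
      push_cast
      field_simp
      ring
    have hlim : Tendsto (fun k : ℕ => Real.exp (-(k * ε * ρ ^ 2 / 2)) +
        ((s + n).choose s : ℝ) * ∑ i ∈ Finset.range (s + n + 1),
        ((⌊a * k⌋₊ + s + n + 1).choose i : ℝ) *
          ((N + k - (⌊a * k⌋₊ + s + n + 1)).choose (N - i) : ℝ) / ((N + k).choose N : ℝ)) atTop
        (𝓝 (0 + discardBound n s N a)) := by
      refine Tendsto.add ?_ (Tendsto.const_mul _ (tendsto_finsetSum _ fun i hi => ?_))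
      · refine Real.tendsto_exp_atBot.comp (tendsto_neg_atTop_atBot.comp ?_)
        have : Tendsto (fun k : ℕ => (k : ℝ) * (ε * ρ ^ 2 / 2)) atTop atTop :=
          tendsto_natCast_atTop_atTop.atTop_mul_const (by positivity)
        exact this.congr fun k => by ring
      · have hi' : i ≤ N := by have := Finset.mem_range.1 hi; omega
        exact tendsto_hypergeometric hm (fun k => by have := hfl k; omega) hJ hi'
    rw [zero_add] at hlim
    exact ge_of_tendsto' hlim hk
  have hcont : Tendsto (fun ρ : ℝ => discardBound n s N ((1 - ρ) * ε)) (𝓝[>] 0)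
      (𝓝 (discardBound n s N ε)) := by
    have : Continuous fun ρ : ℝ => discardBound n s N ((1 - ρ) * ε) := by
      unfold discardBound
      fun_prop
    have h := this.tendsto 0
    simp only [sub_zero, one_mul] at h
    exact h.mono_left nhdsWithin_le_nhds
  refine ge_of_tendsto hcont ?_
  filter_upwards [Ioo_mem_nhdsGT (zero_lt_one' ℝ)] with ρ h
  exact hρ ρ h

end UncertainProgram

end Sampling

end SeqRand

namespace SeqRand

/-! ### Error budget and the union bound over iterations. -/

section Main

variable {n : ℕ} {Q : Type*}

lemma runFrom_zero_violation_le_iff [MeasurableSpace Q] (μ : Measure Q) (P : UncertainProgram n Q)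
    (ε β : ℝ) {Nd : ℕ → ℕ} (Nr : ℕ → ℕ) {M : ℕ → ℕ}
    (sol : (k : ℕ) → (Fin (Nd k) → Q) → EuclideanSpace ℝ (Fin n))
    (qd : (k : ℕ) → Fin (Nd k) → Q) (qv : (k : ℕ) → Fin (M k) → Q) (k : ℕ) :
    (∀ k' θ, runFrom P ε β Nr sol qd qv 0 k = .solution k' θ → P.violation μ θ ≤ ε) ↔
      (P.DiscardedFeasible (Nr k) (qd k) → P.violation μ (sol k (qd k)) ≤ ε) := by
  unfold runFrom
  split_ifs with h
  · constructor
    · intro H _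
      exact H k _ rfl
    · rintro H k' θ heq
      obtain ⟨rfl, rfl⟩ := Outcome.solution.inj heq
      exact H h
  · exact ⟨fun _ h' => absurd h' h, fun _ _ _ heq => nomatch heq⟩

lemma runFrom_succ_violation_le_iff [MeasurableSpace Q] (μ : Measure Q) (P : UncertainProgram n Q)
    (ε β : ℝ) {Nd : ℕ → ℕ} (Nr : ℕ → ℕ) {M : ℕ → ℕ}
    (sol : (k : ℕ) → (Fin (Nd k) → Q) → EuclideanSpace ℝ (Fin n))
    (qd : (k : ℕ) → Fin (Nd k) → Q) (qv : (k : ℕ) → Fin (M k) → Q) (j k : ℕ) :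
    (∀ k' θ, runFrom P ε β Nr sol qd qv (j + 1) k = .solution k' θ → P.violation μ θ ≤ ε) ↔
      (P.DiscardedFeasible (Nr k) (qd k) →
        (P.empViolation (sol k (qd k)) (qv k) ≤ (1 - ((k : ℝ) * β) ^ (-(1 / 2) : ℝ)) * ε ∧
          P.violation μ (sol k (qd k)) ≤ ε) ∨
        (¬ P.empViolation (sol k (qd k)) (qv k) ≤ (1 - ((k : ℝ) * β) ^ (-(1 / 2) : ℝ)) * ε ∧
          ∀ k' θ, runFrom P ε β Nr sol qd qv j (k + 1) = .solution k' θ →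
            P.violation μ θ ≤ ε)) := by
  rw [runFrom]
  split_ifs with h h'
  · constructor
    · intro H _
      exact Or.inl ⟨h', H k _ rfl⟩
    · rintro H k' θ heq
      obtain ⟨rfl, rfl⟩ := Outcome.solution.inj heq
      rcases H h with H | H
      · exact H.2
      · exact absurd h' H.1
  · constructor
    · intro H _
      exact Or.inr ⟨h', H⟩
    · intro H
      rcases H h with H | H
      · exact absurd H.1 h'
      · exact H.2
  · exact ⟨fun _ h' => absurd h' h, fun _ _ _ heq => nomatch heq⟩

/-- The validation sample sizes make the Chernoff bound at most `δ / (2 k_t)`. -/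
lemma exp_validation_le {ε δ β M k t : ℝ} (hε : 0 < ε) (hδ : 0 < δ) (hβ : 1 ≤ β) (hk : 1 ≤ k)
    (ht : 0 < t) (hM : 2 * k * β * (1 / ε) * Real.log (2 * t / δ) ≤ M) :
    Real.exp (-(M * ε * ((k * β) ^ (-(1 / 2) : ℝ)) ^ 2 / 2)) ≤ δ / (2 * t) := by
  have hkβ : 0 < k * β := by positivity
  -- The weaker threshold in early iterations is exactly paid for: `k * β` cancels against the
  -- sample size.
  have h1 : ((k * β) ^ (-(1 / 2) : ℝ)) ^ 2 = (k * β)⁻¹ := by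
    rw [← Real.rpow_natCast, ← Real.rpow_mul hkβ.le, ← Real.rpow_neg_one]
    norm_num
  rw [h1, ← Real.exp_log (show 0 < δ / (2 * t) by positivity), Real.exp_le_exp,
    ← inv_div (2 * t) δ, Real.log_inv, neg_le_neg_iff]
  have h2 := mul_le_mul_of_nonneg_right hM (show 0 ≤ ε * (k * β)⁻¹ / 2 by positivity)
  have h3 : 2 * k * β * (1 / ε) * Real.log (2 * t / δ) * (ε * (k * β)⁻¹ / 2)
      = Real.log (2 * t / δ) := by
    field_simp
  rw [h3] at h2
  refine h2.trans (le_of_eq ?_)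
  ring

/-- For `k = k_t` the size conditions read `N ≤ Nd kt` and `N - r ≤ Nr kt`. The number `s ≤ r`
actually discarded only improves the bound. -/
lemma AdmissibleSizes.design_last {ε δ : ℝ} {kt r : ℕ} {Nd Nr M : ℕ → ℕ}
    (h : AdmissibleSizes n ε δ kt r Nd Nr M) (hε₀ : 0 ≤ ε) (hε₁ : ε ≤ 1) (hδ₁ : δ < 1)
    (hkt : 0 < kt) : ∃ s, Nd kt = Nr kt + s ∧ n + 1 ≤ Nr kt ∧ discardBound n s (Nd kt) ε ≤ δ / 2 := by
  obtain ⟨N, ⟨hN, -⟩, hsz⟩ := h.design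
  obtain ⟨h1, h2, h3⟩ := hsz kt hkt le_rfl
  have hkt' : (kt : ℝ) ≠ 0 := by positivity
  rw [mul_div_assoc, div_self hkt', mul_one] at h1 h2
  have h1' : N ≤ Nd kt := by exact_mod_cast h1
  have h2' : N ≤ Nr kt + r := by
    have : (N : ℝ) ≤ Nr kt + r := by linarith
    exact_mod_cast this
  have hNr : r + n < N := by
    by_contra hc
    have h4 := one_le_discardBound (n := n) (r := r) (not_lt.1 hc) hε₀ hε₁
    have h5 : discardBound n r N ε ≤ δ / 2 := hN
    linarith
  refine ⟨Nd kt - Nr kt, by omega, by omega, ?_⟩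
  exact (discardBound_mono h.discarded h1' hε₀ hε₁).trans hN

end Main

end SeqRand

theorem theorem2 {n : ℕ} {Q : Type*} [MeasurableSpace Q] (μ : Measure Q) [IsProbabilityMeasure μ]
    {Ω : Type*} [MeasurableSpace Ω] (Pr : Measure Ω) [IsProbabilityMeasure Pr]
    (P : SeqRand.UncertainProgram n Q)
    (hmeas : Measurable (fun p : P.Θ × Q => P.f p.1 p.2))
    (hconvex : P.IsConvex) (hunique : P.HasUniqueSolutions)
    (ε δ : ℝ) (hε₀ : 0 < ε) (hε₁ : ε < 1) (hδ₀ : 0 < δ) (hδ₁ : δ < 1)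
    (kt : ℕ) (hkt : 1 < kt) (r : ℕ) (Nd Nr M : ℕ → ℕ)
    (hsizes : SeqRand.AdmissibleSizes n ε δ kt r Nd Nr M)
    (sol : (k : ℕ) → (Fin (Nd k) → Q) → EuclideanSpace ℝ (Fin n))
    (hsol : SeqRand.IsDesignSolver P kt Nd Nr sol)
    (hsolmeas : ∀ k, 1 ≤ k → k ≤ kt → AEMeasurable (sol k) (Measure.pi fun _ => μ))
    (qd : (k : ℕ) → Fin (Nd k) → Ω → Q) (qv : (k : ℕ) → Fin (M k) → Ω → Q)
    (hiid : SeqRand.IsIIDSampling μ Pr qd qv) :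
    NullMeasurableSet {ω | ∀ (k : ℕ) (θ : EuclideanSpace ℝ (Fin n)),
      SeqRand.run P ε δ kt Nr sol (fun k i => qd k i ω) (fun k i => qv k i ω)
        = SeqRand.Outcome.solution k θ → P.violation μ θ ≤ ε} Pr ∧
    1 - δ ≤ Pr.real {ω | ∀ (k : ℕ) (θ : EuclideanSpace ℝ (Fin n)),
      SeqRand.run P ε δ kt Nr sol (fun k i => qd k i ω) (fun k i => qv k i ω)
        = SeqRand.Outcome.solution k θ → P.violation μ θ ≤ ε} := by
  open SeqRand UncertainProgram in
  have hΘ := hconvex.2.1.measurableSet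
  have hA := measurableSet_violationSet hmeas hΘ
  have hkt₀ : (0 : ℝ) < kt := by exact_mod_cast (by omega : 0 < kt)
  set β := betaV ε δ kt with hβ
  have hβ₁ : 1 ≤ β := le_max_left _ _
  have hY : ∀ k, MeasurePreserving (fun ω => ((fun i => qd k i ω, fun j => qv k j ω) :
      (Fin (Nd k) → Q) × (Fin (M k) → Q))) Pr
      ((Measure.pi fun _ => μ).prod (Measure.pi fun _ => μ)) := by
    intro k
    let g : Fin (Nd k) ⊕ Fin (M k) → ((k : ℕ) × Fin (Nd k)) ⊕ ((k : ℕ) × Fin (M k)) :=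
      Sum.map (fun i => ⟨k, i⟩) (fun i => ⟨k, i⟩)
    have hg : Function.Injective g :=
      Sum.map_injective.2 ⟨fun i j h => by simpa using h, fun i j h => by simpa using h⟩
    refine measurePreserving_pair_of_iIndepFun (fun p => ?_) hiid.2.2 hg
    rcases p with p | p
    · exact hiid.1 p.1 p.2
    · exact hiid.2.1 p.1 p.2
  have hYd : ∀ k, MeasurePreserving (fun ω i => qd k i ω) Pr (Measure.pi fun _ => μ) := fun k =>
    measurePreserving_fst.comp (hY k)
  -- feasibility, a small violation probability and passing the validation are events
  have hD : ∀ k, 1 ≤ k → k ≤ kt →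
      NullMeasurableSet {ω | P.DiscardedFeasible (Nr k) (fun i => qd k i ω)} Pr := fun k h1 h2 =>
    (nullMeasurableSet_discardedFeasible hmeas hΘ (hsolmeas k h1 h2) (hsol k h1 h2)).preimage
      (hYd k).quasiMeasurePreserving
  have hsolY : ∀ k, 1 ≤ k → k ≤ kt → AEMeasurable (fun ω => sol k (fun i => qd k i ω)) Pr :=
    fun k h1 h2 => (hsolmeas k h1 h2).comp_quasiMeasurePreserving (hYd k).quasiMeasurePreserving
  have hV : ∀ k, 1 ≤ k → k ≤ kt → NullMeasurableSet
      {ω | μ.real (Prod.mk (sol k (fun i => qd k i ω)) ⁻¹' P.violationSet) ≤ ε} Pr :=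
    fun k h1 h2 => (hsolY k h1 h2).nullMeasurableSet_preimage
      (measurableSet_le (measurable_measureReal_section μ hA) measurable_const)
  have hE : ∀ k, 1 ≤ k → k ≤ kt → NullMeasurableSet
      {ω | freq P.violationSet (sol k (fun i => qd k i ω)) (fun j => qv k j ω)
        ≤ (1 - ((k : ℝ) * β) ^ (-(1 / 2) : ℝ)) * ε} Pr :=
    fun k h1 h2 => ((hsolY k h1 h2).prodMk
      (measurable_snd.comp (hY k).measurable).aemeasurable).nullMeasurableSet_preimage
      (measurableSet_le (measurable_freq hA (M k)) measurable_const)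
  -- Backward induction: each of the `j` remaining validations costs `δ / (2 * kt)` and the final
  -- design costs `δ / 2`.
  have key : ∀ j k, 1 ≤ k → k + j = kt →
      NullMeasurableSet {ω | ∀ k' θ, runFrom P ε β Nr sol (fun k i => qd k i ω)
        (fun k i => qv k i ω) j k = .solution k' θ → P.violation μ θ ≤ ε} Pr ∧
      Pr.real {ω | ∀ k' θ, runFrom P ε β Nr sol (fun k i => qd k i ω)
        (fun k i => qv k i ω) j k = .solution k' θ → P.violation μ θ ≤ ε}ᶜ
        ≤ j * (δ / (2 * kt)) + δ / 2 := by
    intro j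
    induction j with
    | zero =>
      intro k hk hkj
      obtain rfl : k = kt := by omega
      simp only [runFrom_zero_violation_le_iff]
      constructor
      · have h1 : {ω | P.DiscardedFeasible (Nr k) (fun i => qd k i ω) →
            P.violation μ (sol k (fun i => qd k i ω)) ≤ ε}
            = {ω | P.DiscardedFeasible (Nr k) (fun i => qd k i ω)}ᶜ ∪
              {ω | μ.real (Prod.mk (sol k (fun i => qd k i ω)) ⁻¹' P.violationSet) ≤ ε} := by
          ext ω
          by_cases hf : P.DiscardedFeasible (Nr k) (fun i => qd k i ω)
          · simp [hf, measureReal_violationSet_section μ (hsol k hk le_rfl _ hf).mem]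
          · simp [hf]
        rw [h1]
        exact (hD k hk le_rfl).compl.union (hV k hk le_rfl)
      · obtain ⟨s, hs, hl, hb⟩ := hsizes.design_last hε₀.le hε₁.le hδ₁ hk
        have h1 := measureReal_lt_violation_le_discardBound hmeas hconvex hunique hs hl
          (hsolmeas k hk le_rfl) (hsol k hk le_rfl) hε₀ hε₁
        have h2 : {ω | P.DiscardedFeasible (Nr k) (fun i => qd k i ω) →
            P.violation μ (sol k (fun i => qd k i ω)) ≤ ε}ᶜ
            = (fun ω i => qd k i ω) ⁻¹' {q | P.DiscardedFeasible (Nr k) q ∧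
              ε < P.violation μ (sol k q)} := by
          ext ω; simp
        have h3 : NullMeasurableSet {q | P.DiscardedFeasible (Nr k) q ∧
              ε < P.violation μ (sol k q)} (Measure.pi fun _ => μ) := by
          have h4 : {q | P.DiscardedFeasible (Nr k) q ∧ ε < P.violation μ (sol k q)}
              = {q | P.DiscardedFeasible (Nr k) q} ∩
                sol k ⁻¹' {θ | ε < μ.real (Prod.mk θ ⁻¹' P.violationSet)} := by
            ext q
            refine and_congr_right fun hf => ?_
            simp [measureReal_violationSet_section μ (hsol k hk le_rfl _ hf).mem]
          rw [h4]
          exact (nullMeasurableSet_discardedFeasible hmeas hΘ (hsolmeas k hk le_rfl)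
            (hsol k hk le_rfl)).inter ((hsolmeas k hk le_rfl).nullMeasurableSet_preimage
              (measurableSet_lt measurable_const (measurable_measureReal_section μ hA)))
        rw [h2, measureReal_def, (hYd k).measure_preimage h3, ← measureReal_def]
        simpa using h1.trans hb
    | succ j ih =>
      intro k hk hkj
      have hk' : k ≤ kt := by omega
      obtain ⟨ih1, ih2⟩ := ih (k + 1) (by omega) (by omega)
      simp only [runFrom_succ_violation_le_iff]
      set Good := {ω | ∀ k' θ, runFrom P ε β Nr sol (fun k i => qd k i ω)
        (fun k i => qv k i ω) j (k + 1) = .solution k' θ → P.violation μ θ ≤ ε} with hGood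
      constructor
      · have h1 : {ω | P.DiscardedFeasible (Nr k) (fun i => qd k i ω) →
            (P.empViolation (sol k (fun i => qd k i ω)) (fun i => qv k i ω)
              ≤ (1 - ((k : ℝ) * β) ^ (-(1 / 2) : ℝ)) * ε ∧
              P.violation μ (sol k (fun i => qd k i ω)) ≤ ε) ∨
            (¬ P.empViolation (sol k (fun i => qd k i ω)) (fun i => qv k i ω)
              ≤ (1 - ((k : ℝ) * β) ^ (-(1 / 2) : ℝ)) * ε ∧
              ∀ k' θ, runFrom P ε β Nr sol (fun k i => qd k i ω)
              (fun k i => qv k i ω) j (k + 1) = .solution k' θ → P.violation μ θ ≤ ε)}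
            = {ω | P.DiscardedFeasible (Nr k) (fun i => qd k i ω)}ᶜ ∪
              (({ω | freq P.violationSet (sol k (fun i => qd k i ω)) (fun j => qv k j ω)
                ≤ (1 - ((k : ℝ) * β) ^ (-(1 / 2) : ℝ)) * ε} ∩
              {ω | μ.real (Prod.mk (sol k (fun i => qd k i ω)) ⁻¹' P.violationSet) ≤ ε}) ∪
              ({ω | freq P.violationSet (sol k (fun i => qd k i ω)) (fun j => qv k j ω)
                ≤ (1 - ((k : ℝ) * β) ^ (-(1 / 2) : ℝ)) * ε}ᶜ ∩ Good)) := by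
          ext ω
          by_cases hf : P.DiscardedFeasible (Nr k) (fun i => qd k i ω)
          · have hθ := (hsol k hk hk' _ hf).mem
            simp only [Set.mem_ofPred_eq, Set.mem_union, Set.mem_inter_iff, Set.mem_compl_iff, hf,
              measureReal_violationSet_section μ hθ, freq_violationSet hθ, true_imp_iff,
              not_true, false_or, hGood]
          · simp [hf]
        rw [h1]
        exact (hD k hk hk').compl.union (((hE k hk hk').inter (hV k hk hk')).union
          ((hE k hk hk').compl.inter ih1))
      -- `B` is the event that the design is bad and yet passes the validation. Outside it, a
      -- failure must come from a later iteration.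
      · set B : Set ((Fin (Nd k) → Q) × (Fin (M k) → Q)) :=
          {p | ε < μ.real (Prod.mk (sol k p.1) ⁻¹' P.violationSet) ∧
            freq P.violationSet (sol k p.1) p.2 ≤ (1 - ((k : ℝ) * β) ^ (-(1 / 2) : ℝ)) * ε} with hB
        have hBn : NullMeasurableSet B ((Measure.pi fun _ => μ).prod (Measure.pi fun _ => μ)) :=
          nullMeasurableSet_lt_section_and_freq_le μ hA (hsolmeas k hk hk') ε _ (M k)
        have h1 := measureReal_freq_le_of_lt μ (Measure.pi fun _ => μ) hA (hsolmeas k hk hk')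
          hε₀.le (ρ := ((k : ℝ) * β) ^ (-(1 / 2) : ℝ)) (by positivity) (M k)
        have h2 := h1.trans (exp_validation_le hε₀ hδ₀ hβ₁ (by exact_mod_cast hk) hkt₀
          (hsizes.validation k hk (by omega)))
        have h3 : Pr.real ((fun ω => ((fun i => qd k i ω, fun j => qv k j ω) :
            (Fin (Nd k) → Q) × (Fin (M k) → Q))) ⁻¹' B) ≤ δ / (2 * kt) := by
          rw [measureReal_def, (hY k).measure_preimage hBn, ← measureReal_def]
          exact h2
        refine (measureReal_mono (s₂ := (fun ω => ((fun i => qd k i ω, fun j => qv k j ω) :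
            (Fin (Nd k) → Q) × (Fin (M k) → Q))) ⁻¹' B ∪ Goodᶜ) ?_ (measure_ne_top _ _)).trans
          ((measureReal_union_le _ _).trans ((add_le_add h3 ih2).trans (le_of_eq ?_)))
        · intro ω hω
          by_contra hc
          rw [Set.mem_union, not_or] at hc
          obtain ⟨hc1, hc2⟩ := hc
          refine hω fun hf => ?_
          have hθ := (hsol k hk hk' _ hf).mem
          by_cases he : P.empViolation (sol k (fun i => qd k i ω)) (fun i => qv k i ω)
              ≤ (1 - ((k : ℝ) * β) ^ (-(1 / 2) : ℝ)) * ε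
          · refine Or.inl ⟨he, not_lt.1 fun hv => hc1 ⟨?_, ?_⟩⟩
            · rw [measureReal_violationSet_section μ hθ]; exact hv
            · rw [freq_violationSet hθ]; exact he
          · exact Or.inr ⟨he, not_not.1 hc2⟩
        · push_cast
          ring
  obtain ⟨h1, h2⟩ := key (kt - 1) 1 le_rfl (by omega)
  refine ⟨h1, ?_⟩
  have h3 := probReal_compl_eq_one_sub₀ h1
  rw [h3] at h2
  have h4 : ((kt - 1 : ℕ) : ℝ) * (δ / (2 * kt)) ≤ δ / 2 := by
    rw [Nat.cast_sub hkt.le, Nat.cast_one]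
    have : (kt : ℝ) * (δ / (2 * kt)) = δ / 2 := by field_simp
    have h5 : 0 < δ / (2 * kt) := by positivity
    nlinarith
  unfold run
  linarith
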